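/- Let $T$ be the right shift on $\ell^2(\mathbb{Z}_+)$, let $T_{n,m}=T^nT^{*m}$ for $n,m\in\mathbb{Z}_+$, let $\mathcal{T}\subset\mathcal{B}(\ell^2(\mathbb{Z}_+))$ be the Toeplitz algebra, i.e. the norm closed subalgebra generated by $T$ and $T^*$, and let $\Delta:\mathcal{T}\to\mathcal{T}\otimes\mathcal{T}$ (minimal $C^*$-tensor product) be the unital $*$-homomorphism with $\Delta(T)=T\otimes T$. Let $\mathcal{T}^*$ be the (commutative) Banach algebra of all continuous linear functionals on $\mathcal{T}$, with the dual norm and the product $(\rho*\varphi)(A)=(\rho\otimes\varphi)(\Delta(A))$. Then: 1. There is a unique continuous linear functional $\epsilon\in\mathcal{T}^*$ with $\epsilon(T_{n,m})=1$ for all $n,m\in\mathbb{Z}_+$. 2. The algebra $\mathcal{K}$ of compact operators on $\ell^2(\mathbb{Z}_+)$ is contained in $\mathcal{T}$, there is an isometric isomorphism $\mathcal{T}/\mathcal{K}\cong C(S^1)$ such that the composition $\gamma:\mathcal{T}\to\mathcal{T}/\mathcal{K}\cong C(S^1)$ (the symbol map) is a unital $*$-homomorphism with $\gamma(T_{n,m})(z)=z^{m-n}$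 for all $n,m\in\mathbb{Z}_+$, $z\in S^1$, and $\epsilon(A)=\gamma(A)(1)$ for all $A\in\mathcal{T}$. 3. $\epsilon$ is the unit of the Banach algebra $\mathcal{T}^*$: $\|\epsilon\|=1$ and $\epsilon*\rho=\rho=\rho*\epsilon$ for all $\rho\in\mathcal{T}^*$. 4. $\epsilon$ is a counit for $(\mathcal{T},\Delta)$: $(\epsilon\otimes\mathrm{id})(\Delta(A))=A=(\mathrm{id}\otimes\epsilon)(\Delta(A))$ for all $A\in\mathcal{T}$. -/

import Mathlib

open scoped TensorProduct InnerProductSpace ComplexConjugate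
open UniformSpace


noncomputable section

namespace ToeplitzQSG

section Tensor

variable {H K : Type*}
  [NormedAddCommGroup H] [InnerProductSpace ℂ H]
  [NormedAddCommGroup K] [InnerProductSpace ℂ K]

variable (H K) in
/-- The Hilbert space tensor product of `H` and `K`: the completion of the algebraic tensor
product for the inner product `⟪a ⊗ b, c ⊗ d⟫ = ⟪a, c⟫ * ⟪b, d⟫`. -/
def HTensor : Type _ := Completion (H ⊗[ℂ] K)

instance : NormedAddCommGroup (HTensor H K) :=
  inferInstanceAs (NormedAddCommGroup (Completion (H ⊗[ℂ] K)))

instance : InnerProductSpace ℂ (HTensor H K) :=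
  inferInstanceAs (InnerProductSpace ℂ (Completion (H ⊗[ℂ] K)))

instance : CompleteSpace (HTensor H K) :=
  inferInstanceAs (CompleteSpace (Completion (H ⊗[ℂ] K)))

variable (H K) in
/-- The inclusion of the algebraic tensor product. -/
def ofAlg : H ⊗[ℂ] K →ₗᵢ[ℂ] HTensor H K := Completion.toComplₗᵢ

theorem denseRange_ofAlg : DenseRange (ofAlg H K) := Completion.denseRange_coe

variable (H K) in
/-- The bounded bilinear map `(h, k) ↦ h ⊗ k`. -/
def tmulL : H →L[ℂ] K →L[ℂ] HTensor H K :=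
  (ContinuousLinearMap.compL ℂ K (H ⊗[ℂ] K) (HTensor H K) (ofAlg H K).toContinuousLinearMap).comp
    (TensorProduct.mkL ℂ H K)

theorem tmulL_apply (h : H) (k : K) : tmulL H K h k = ofAlg H K (h ⊗ₜ[ℂ] k) :=
  rfl

theorem inner_tmulL (h h' : H) (k k' : K) :
    ⟪tmulL H K h k, tmulL H K h' k'⟫_ℂ = ⟪h, h'⟫_ℂ * ⟪k, k'⟫_ℂ := by
  simp [tmulL_apply]

theorem dense_tmulL :
    Dense ((Submodule.span ℂ {z | ∃ h k, tmulL H K h k = z} : Submodule ℂ (HTensor H K)) :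
      Set (HTensor H K)) := by
  refine denseRange_ofAlg.mono ?_
  rintro _ ⟨t, rfl⟩
  induction t using TensorProduct.induction_on with
  | zero => simp
  | tmul h k => exact Submodule.subset_span ⟨h, k, rfl⟩
  | add a b ha hb =>
    rw [map_add]
    exact Submodule.add_mem _ ha hb

/-- Two bounded operators on a Hilbert tensor product agreeing on elementary tensors are equal. -/
theorem htensor_ext {M : Type*} [NormedAddCommGroup M] [NormedSpace ℂ M]
    {f g : HTensor H K →L[ℂ] M} (h : ∀ a b, f (tmulL H K a b) = g (tmulL H K a b)) : f = g := by
  refine ContinuousLinearMap.ext_on dense_tmulL ?_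
  rintro _ ⟨a, b, rfl⟩
  exact h a b

/-- The operator `a ⊗ b` on the Hilbert tensor product. -/
def tensorOp (a : H →L[ℂ] H) (b : K →L[ℂ] K) : HTensor H K →L[ℂ] HTensor H K :=
  ContinuousLinearMap.completion (TensorProduct.mapL a b)

theorem tensorOp_ofAlg (a : H →L[ℂ] H) (b : K →L[ℂ] K) (t : H ⊗[ℂ] K) :
    tensorOp a b (ofAlg H K t) = ofAlg H K (TensorProduct.mapL a b t) :=
  Completion.map_coe (TensorProduct.mapL a b).uniformContinuous t

@[simp]
theorem tensorOp_tmulL (a : H →L[ℂ] H) (b : K →L[ℂ] K) (h : H) (k : K) :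
    tensorOp a b (tmulL H K h k) = tmulL H K (a h) (b k) := by
  simp [tmulL_apply, tensorOp_ofAlg]

theorem tensorOp_mul (a a' : H →L[ℂ] H) (b b' : K →L[ℂ] K) :
    tensorOp a b * tensorOp a' b' = tensorOp (a * a') (b * b') :=
  htensor_ext fun h k => by simp

theorem tensorOp_one : tensorOp (1 : H →L[ℂ] H) (1 : K →L[ℂ] K) = 1 :=
  htensor_ext fun h k => by simp

variable [CompleteSpace H] [CompleteSpace K]

theorem tensorOp_star (a : H →L[ℂ] H) (b : K →L[ℂ] K) :
    star (tensorOp a b) = tensorOp (star a) (star b) := by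
  rw [ContinuousLinearMap.star_eq_adjoint, eq_comm, ContinuousLinearMap.eq_adjoint_iff]
  intro x y
  induction x, y using denseRange_ofAlg.induction_on₂ with
  | hp => exact isClosed_eq (by fun_prop) (by fun_prop)
  | h s t =>
    rw [tensorOp_ofAlg, tensorOp_ofAlg, LinearIsometry.inner_map_map, LinearIsometry.inner_map_map]
    induction s using TensorProduct.induction_on with
    | zero => simp
    | add u v hu hv => rw [map_add, inner_add_left, inner_add_left, hu, hv]
    | tmul h k =>
      induction t using TensorProduct.induction_on with
      | zero => simp
      | add u v hu hv => rw [map_add, inner_add_right, inner_add_right, hu, hv]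
      | tmul h' k' =>
        simp [ContinuousLinearMap.star_eq_adjoint, ContinuousLinearMap.adjoint_inner_left]

/-- The minimal (spatial) tensor product of the concrete algebras `S` and `R`: the norm closed
`*`-subalgebra of the operators on the Hilbert tensor product generated by the `a ⊗ b`. -/
def minTensor (S : StarSubalgebra ℂ (H →L[ℂ] H)) (R : StarSubalgebra ℂ (K →L[ℂ] K)) :
    StarSubalgebra ℂ (HTensor H K →L[ℂ] HTensor H K) :=
  (StarAlgebra.adjoin ℂ {x | ∃ a ∈ S, ∃ b ∈ R, tensorOp a b = x}).topologicalClosure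

instance isClosed_minTensor (S : StarSubalgebra ℂ (H →L[ℂ] H)) (R : StarSubalgebra ℂ (K →L[ℂ] K)) :
    IsClosed (minTensor S R : Set (HTensor H K →L[ℂ] HTensor H K)) :=
  StarSubalgebra.isClosed_topologicalClosure _

theorem tensorOp_mem {S : StarSubalgebra ℂ (H →L[ℂ] H)} {R : StarSubalgebra ℂ (K →L[ℂ] K)}
    {a : H →L[ℂ] H} {b : K →L[ℂ] K} (ha : a ∈ S) (hb : b ∈ R) : tensorOp a b ∈ minTensor S R :=
  StarSubalgebra.le_topologicalClosure _ (StarAlgebra.subset_adjoin ℂ _ ⟨a, ha, b, hb, rfl⟩)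

/-- The linear span of the elementary tensors is dense in the tensor product. -/
theorem minTensor_subset {S : StarSubalgebra ℂ (H →L[ℂ] H)} {R : StarSubalgebra ℂ (K →L[ℂ] K)}
    {V : Submodule ℂ (HTensor H K →L[ℂ] HTensor H K)}
    (hV : IsClosed (V : Set (HTensor H K →L[ℂ] HTensor H K)))
    (h : ∀ a ∈ S, ∀ b ∈ R, tensorOp a b ∈ V) {x : HTensor H K →L[ℂ] HTensor H K}
    (hx : x ∈ minTensor S R) : x ∈ V := by
  set W : Submodule ℂ (HTensor H K →L[ℂ] HTensor H K) :=
    Submodule.span ℂ {x | ∃ a ∈ S, ∃ b ∈ R, tensorOp a b = x} with hW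
  have hWV : W ≤ V := Submodule.span_le.2 (by rintro _ ⟨a, ha, b, hb, rfl⟩; exact h a ha b hb)
  have hmul : ∀ x ∈ W, ∀ y ∈ W, x * y ∈ W := by
    intro x hx y hy
    have := Submodule.mul_mem_mul hx hy
    rw [hW, Submodule.span_mul_span] at this
    refine Submodule.span_mono ?_ this
    rintro _ ⟨_, ⟨a, ha, b, hb, rfl⟩, _, ⟨a', ha', b', hb', rfl⟩, rfl⟩
    exact ⟨a * a', mul_mem ha ha', b * b', mul_mem hb hb', (tensorOp_mul _ _ _ _).symm⟩
  have hstar : ∀ x ∈ W, star x ∈ W := by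
    intro x hx
    induction hx using Submodule.span_induction with
    | zero => simp
    | add x y _ _ hx hy => rw [star_add]; exact W.add_mem hx hy
    | smul c x _ hx => rw [star_smul]; exact W.smul_mem _ hx
    | mem x hx =>
      obtain ⟨a, ha, b, hb, rfl⟩ := hx
      exact Submodule.subset_span ⟨_, star_mem ha, _, star_mem hb, (tensorOp_star a b).symm⟩
  have hle : ∀ x ∈ StarAlgebra.adjoin ℂ {x | ∃ a ∈ S, ∃ b ∈ R, tensorOp a b = x}, x ∈ W := by
    intro x hx
    induction hx using StarAlgebra.adjoin_induction with
    | mem x hx => exact Submodule.subset_span hx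
    | algebraMap r =>
      rw [Algebra.algebraMap_eq_smul_one, ← tensorOp_one]
      exact W.smul_mem _ (Submodule.subset_span ⟨1, one_mem _, 1, one_mem _, rfl⟩)
    | add x y _ _ hx hy => exact W.add_mem hx hy
    | mul x y _ _ hx hy => exact hmul x hx y hy
    | star x _ hx => exact hstar x hx
  exact closure_minimal (fun x hx => hWV (hle x hx)) hV hx

end Tensor

section Slice
variable {H K M : Type*}
  [NormedAddCommGroup H] [InnerProductSpace ℂ H] [CompleteSpace H]
  [NormedAddCommGroup K] [InnerProductSpace ℂ K] [CompleteSpace K]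
  [NormedAddCommGroup M] [InnerProductSpace ℂ M] [CompleteSpace M]

/-- For `J k h = h ⊗ k` (or `J h k = h ⊗ k`), slicing an operator `x` on the Hilbert tensor product
by a functional `ρ` is done through the sesquilinear form `(η, ξ) ↦ ρ ((J η)† x (J ξ))`. -/
def sliceForm (J : K →L[ℂ] H →L[ℂ] M) (ρ : StrongDual ℂ (H →L[ℂ] H)) (x : M →L[ℂ] M) :
    K →L⋆[ℂ] K →L[ℂ] ℂ :=
  LinearMap.mkContinuous₂
    (LinearMap.mk₂'ₛₗ (starRingEnd ℂ) (RingHom.id ℂ)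
      (fun η ξ => ρ ((J η).adjoint ∘L x ∘L J ξ))
      (fun a b c => by simp [ContinuousLinearMap.add_comp])
      (fun c a b => by
        rw [map_smul, map_smulₛₗ, ContinuousLinearMap.smul_comp, map_smul])
      (fun a b c => by simp [ContinuousLinearMap.comp_add])
      (fun c a b => by simp))
    (‖ρ‖ * ‖J‖ ^ 2 * ‖x‖) (fun η ξ => by
      have h1 : ‖(J η).adjoint ∘L x ∘L J ξ‖ ≤ (‖J‖ * ‖η‖) * (‖x‖ * (‖J‖ * ‖ξ‖)) := by
        refine (ContinuousLinearMap.opNorm_comp_le _ _).trans ?_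
        rw [LinearIsometryEquiv.norm_map]
        refine mul_le_mul (J.le_opNorm η) ?_ (norm_nonneg _) (by positivity)
        refine (ContinuousLinearMap.opNorm_comp_le _ _).trans ?_
        gcongr
        exact J.le_opNorm ξ
      calc ‖ρ ((J η).adjoint ∘L x ∘L J ξ)‖ ≤ ‖ρ‖ * ‖(J η).adjoint ∘L x ∘L J ξ‖ := ρ.le_opNorm _
        _ ≤ ‖ρ‖ * ((‖J‖ * ‖η‖) * (‖x‖ * (‖J‖ * ‖ξ‖))) := by gcongr
        _ = _ := by ring)

theorem sliceForm_apply (J : K →L[ℂ] H →L[ℂ] M) (ρ : StrongDual ℂ (H →L[ℂ] H)) (x : M →L[ℂ] M)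
    (η ξ : K) : sliceForm J ρ x η ξ = ρ ((J η).adjoint ∘L x ∘L J ξ) := rfl

theorem norm_sliceForm_le (J : K →L[ℂ] H →L[ℂ] M) (ρ : StrongDual ℂ (H →L[ℂ] H))
    (x : M →L[ℂ] M) : ‖sliceForm J ρ x‖ ≤ ‖ρ‖ * ‖J‖ ^ 2 * ‖x‖ :=
  LinearMap.mkContinuous₂_norm_le _ (by positivity) _

/-- The operator on `K` with `⟪η, (sliceOp J ρ x) ξ⟫ = ρ ((J η)† x (J ξ))`. -/
def sliceFun (J : K →L[ℂ] H →L[ℂ] M) (ρ : StrongDual ℂ (H →L[ℂ] H)) (x : M →L[ℂ] M) :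
    K →L[ℂ] K :=
  (InnerProductSpace.continuousLinearMapOfBilin (sliceForm J ρ x)).adjoint

theorem inner_sliceFun (J : K →L[ℂ] H →L[ℂ] M) (ρ : StrongDual ℂ (H →L[ℂ] H))
    (x : M →L[ℂ] M) (η ξ : K) :
    ⟪η, sliceFun J ρ x ξ⟫_ℂ = ρ ((J η).adjoint ∘L x ∘L J ξ) := by
  rw [sliceFun, ContinuousLinearMap.adjoint_inner_right,
    InnerProductSpace.continuousLinearMapOfBilin_apply, sliceForm_apply]

/-- `sliceFun` as a bounded linear map in the operator. -/
def sliceOp (J : K →L[ℂ] H →L[ℂ] M) (ρ : StrongDual ℂ (H →L[ℂ] H)) :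
    (M →L[ℂ] M) →L[ℂ] (K →L[ℂ] K) :=
  LinearMap.mkContinuous
    { toFun := sliceFun J ρ
      map_add' := fun x y => by
        ext ξ; refine ext_inner_left ℂ fun η => ?_
        simp [inner_sliceFun, inner_add_right, ContinuousLinearMap.add_comp,
          ContinuousLinearMap.comp_add]
      map_smul' := fun c x => by
        ext ξ; refine ext_inner_left ℂ fun η => ?_
        simp [inner_sliceFun, inner_smul_right, ContinuousLinearMap.smul_comp] }
    (‖ρ‖ * ‖J‖ ^ 2) (fun x => by
      refine le_trans ?_ (norm_sliceForm_le J ρ x)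
      simp only [LinearMap.coe_mk, AddHom.coe_mk, sliceFun, LinearIsometryEquiv.norm_map]
      refine ContinuousLinearMap.opNorm_le_bound _ (sliceForm J ρ x).opNorm_nonneg fun v => ?_
      simp only [InnerProductSpace.continuousLinearMapOfBilin, ContinuousLinearMap.comp_apply]
      refine le_trans (le_of_eq ?_) ((sliceForm J ρ x).le_opNorm v)
      simp )

theorem inner_sliceOp (J : K →L[ℂ] H →L[ℂ] M) (ρ : StrongDual ℂ (H →L[ℂ] H))
    (x : M →L[ℂ] M) (η ξ : K) :
    ⟪η, sliceOp J ρ x ξ⟫_ℂ = ρ ((J η).adjoint ∘L x ∘L J ξ) := inner_sliceFun J ρ x η ξ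

theorem norm_sliceOp_le (J : K →L[ℂ] H →L[ℂ] M) (ρ : StrongDual ℂ (H →L[ℂ] H)) :
    ‖sliceOp J ρ‖ ≤ ‖ρ‖ * ‖J‖ ^ 2 :=
  LinearMap.mkContinuous_norm_le _ (by positivity) _

end Slice

section SliceTensor

variable {H K : Type*}
  [NormedAddCommGroup H] [InnerProductSpace ℂ H] [CompleteSpace H]
  [NormedAddCommGroup K] [InnerProductSpace ℂ K] [CompleteSpace K]

theorem sliceOp_tensorOp (ρ : StrongDual ℂ (H →L[ℂ] H)) (a : H →L[ℂ] H) (b : K →L[ℂ] K) :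
    sliceOp (tmulL H K).flip ρ (tensorOp a b) = ρ a • b := by
  ext ξ
  refine ext_inner_left ℂ fun η => ?_
  rw [inner_sliceOp]
  have : ((tmulL H K).flip η).adjoint ∘L tensorOp a b ∘L (tmulL H K).flip ξ = ⟪η, b ξ⟫_ℂ • a := by
    ext h
    refine ext_inner_left ℂ fun h' => ?_
    simp [ContinuousLinearMap.adjoint_inner_right, inner_tmulL, inner_smul_right, mul_comm]
  rw [this]
  simp [inner_smul_right, mul_comm]

theorem sliceOp_tensorOp' (φ : StrongDual ℂ (K →L[ℂ] K)) (a : H →L[ℂ] H) (b : K →L[ℂ] K) :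
    sliceOp (tmulL H K) φ (tensorOp a b) = φ b • a := by
  ext ξ
  refine ext_inner_left ℂ fun η => ?_
  rw [inner_sliceOp]
  have : (tmulL H K η).adjoint ∘L tensorOp a b ∘L tmulL H K ξ = ⟪η, a ξ⟫_ℂ • b := by
    ext h
    refine ext_inner_left ℂ fun h' => ?_
    simp [ContinuousLinearMap.adjoint_inner_right, inner_tmulL, inner_smul_right]
  rw [this]
  simp [inner_smul_right, mul_comm]

theorem norm_tmulL_le : ‖tmulL H K‖ ≤ 1 := by
  refine ContinuousLinearMap.opNorm_le_bound₂ _ zero_le_one fun h k => ?_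
  rw [tmulL_apply, LinearIsometry.norm_map]
  simp

theorem exists_extension (S : StarSubalgebra ℂ (H →L[ℂ] H)) (ρ : StrongDual ℂ S) :
    ∃ ρ' : StrongDual ℂ (H →L[ℂ] H), (∀ a : S, ρ' a = ρ a) ∧ ‖ρ'‖ = ‖ρ‖ :=
  exists_extension_norm_eq (Subalgebra.toSubmodule S.toSubalgebra) ρ

variable (S : StarSubalgebra ℂ (H →L[ℂ] H)) (R : StarSubalgebra ℂ (K →L[ℂ] K))

/-- A norm preserving extension of a functional to all bounded operators. -/
def extendDual (ρ : StrongDual ℂ S) : StrongDual ℂ (H →L[ℂ] H) := (exists_extension S ρ).choose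

theorem extendDual_apply (ρ : StrongDual ℂ S) (a : H →L[ℂ] H) (ha : a ∈ S) :
    extendDual S ρ a = ρ ⟨a, ha⟩ := (exists_extension S ρ).choose_spec.1 ⟨a, ha⟩

theorem norm_extendDual (ρ : StrongDual ℂ S) : ‖extendDual S ρ‖ = ‖ρ‖ :=
  (exists_extension S ρ).choose_spec.2

theorem sliceOp_mem [hR : IsClosed (R : Set (K →L[ℂ] K))] (ρ : StrongDual ℂ S)
    (x : minTensor S R) : sliceOp (tmulL H K).flip (extendDual S ρ) x ∈ R := by
  refine minTensor_subset
    (V := (Subalgebra.toSubmodule R.toSubalgebra).comap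
      (sliceOp (tmulL H K).flip (extendDual S ρ)).toLinearMap)
    (hR.preimage (sliceOp (tmulL H K).flip (extendDual S ρ)).continuous) ?_ x.2
  intro a ha b hb
  change sliceOp _ _ _ ∈ R
  rw [sliceOp_tensorOp]
  exact R.smul_mem hb _

theorem sliceOp_mem' [hS : IsClosed (S : Set (H →L[ℂ] H))] (φ : StrongDual ℂ R)
    (x : minTensor S R) : sliceOp (tmulL H K) (extendDual R φ) x ∈ S := by
  refine minTensor_subset
    (V := (Subalgebra.toSubmodule S.toSubalgebra).comap
      (sliceOp (tmulL H K) (extendDual R φ)).toLinearMap)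
    (hS.preimage (sliceOp (tmulL H K) (extendDual R φ)).continuous) ?_ x.2
  intro a ha b hb
  change sliceOp _ _ _ ∈ S
  rw [sliceOp_tensorOp']
  exact S.smul_mem ha _

/-- The slice map `ρ ⊗ id : S ⊗ R → R`, i.e. the continuous linear map with
`a ⊗ b ↦ ρ(a) b`. -/
def sliceLeft [IsClosed (R : Set (K →L[ℂ] K))] (ρ : StrongDual ℂ S) : minTensor S R →L[ℂ] R where
  toFun x := ⟨sliceOp (tmulL H K).flip (extendDual S ρ) x, sliceOp_mem S R ρ x⟩
  map_add' x y := Subtype.ext (map_add (sliceOp (tmulL H K).flip (extendDual S ρ)) x.1 y.1)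
  map_smul' c x := Subtype.ext (map_smul (sliceOp (tmulL H K).flip (extendDual S ρ)) c x.1)
  cont := Continuous.subtype_mk
    ((sliceOp (tmulL H K).flip (extendDual S ρ)).continuous.comp continuous_subtype_val) _

/-- The slice map `id ⊗ φ : S ⊗ R → S`, i.e. the continuous linear map with
`a ⊗ b ↦ φ(b) a`. -/
def sliceRight [IsClosed (S : Set (H →L[ℂ] H))] (φ : StrongDual ℂ R) : minTensor S R →L[ℂ] S where
  toFun x := ⟨sliceOp (tmulL H K) (extendDual R φ) x, sliceOp_mem' S R φ x⟩
  map_add' x y := Subtype.ext (map_add (sliceOp (tmulL H K) (extendDual R φ)) x.1 y.1)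
  map_smul' c x := Subtype.ext (map_smul (sliceOp (tmulL H K) (extendDual R φ)) c x.1)
  cont := Continuous.subtype_mk
    ((sliceOp (tmulL H K) (extendDual R φ)).continuous.comp continuous_subtype_val) _

variable {S R}

/-- The elementary tensor `a ⊗ b` as an element of `S ⊗ R`. -/
def elemTensor (a : S) (b : R) : minTensor S R := ⟨tensorOp a.1 b.1, tensorOp_mem a.2 b.2⟩

theorem sliceLeft_elemTensor [IsClosed (R : Set (K →L[ℂ] K))] (ρ : StrongDual ℂ S) (a : S) (b : R) :
    sliceLeft S R ρ (elemTensor a b) = ρ a • b := by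
  refine Subtype.ext ?_
  change sliceOp (tmulL H K).flip (extendDual S ρ) (tensorOp a.1 b.1) = ρ a • b.1
  rw [sliceOp_tensorOp, extendDual_apply _ _ _ a.2]

theorem sliceRight_elemTensor [IsClosed (S : Set (H →L[ℂ] H))] (φ : StrongDual ℂ R) (a : S)
    (b : R) : sliceRight S R φ (elemTensor a b) = φ b • a := by
  refine Subtype.ext ?_
  change sliceOp (tmulL H K) (extendDual R φ) (tensorOp a.1 b.1) = φ b • a.1
  rw [sliceOp_tensorOp', extendDual_apply _ _ _ b.2]

theorem norm_sliceLeft_le [IsClosed (R : Set (K →L[ℂ] K))] (ρ : StrongDual ℂ S) :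
    ‖sliceLeft S R ρ‖ ≤ ‖ρ‖ := by
  refine ContinuousLinearMap.opNorm_le_bound _ (norm_nonneg _) fun x => ?_
  have h2 := (sliceOp (tmulL H K).flip (extendDual S ρ)).le_opNorm x.1
  have h3 := norm_sliceOp_le (tmulL H K).flip (extendDual S ρ)
  rw [norm_extendDual, ContinuousLinearMap.opNorm_flip] at h3
  have h4 : ‖ρ‖ * ‖tmulL H K‖ ^ 2 ≤ ‖ρ‖ :=
    mul_le_of_le_one_right (norm_nonneg _) (pow_le_one₀ (tmulL H K).opNorm_nonneg norm_tmulL_le)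
  exact h2.trans (mul_le_mul_of_nonneg_right (h3.trans h4) (norm_nonneg _))

/-- The tensor product `ρ ⊗ φ` of two continuous functionals: the continuous functional on
`S ⊗ R` with `a ⊗ b ↦ ρ(a) φ(b)`. -/
def tensorDual [IsClosed (R : Set (K →L[ℂ] K))] (ρ : StrongDual ℂ S) (φ : StrongDual ℂ R) :
    StrongDual ℂ (minTensor S R) := φ ∘L sliceLeft S R ρ

theorem tensorDual_elemTensor [IsClosed (R : Set (K →L[ℂ] K))] (ρ : StrongDual ℂ S)
    (φ : StrongDual ℂ R) (a : S) (b : R) : tensorDual ρ φ (elemTensor a b) = ρ a * φ b := by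
  simp [tensorDual, sliceLeft_elemTensor]

theorem norm_tensorDual_le [IsClosed (R : Set (K →L[ℂ] K))] (ρ : StrongDual ℂ S)
    (φ : StrongDual ℂ R) : ‖tensorDual ρ φ‖ ≤ ‖ρ‖ * ‖φ‖ := by
  refine (ContinuousLinearMap.opNorm_comp_le _ _).trans ?_
  rw [mul_comm]
  exact mul_le_mul_of_nonneg_right (norm_sliceLeft_le ρ) (norm_nonneg _)

end SliceTensor

section Basis

/-- The Hilbert space `ℓ²(ι)`. -/
abbrev L2 (ι : Type) : Type := lp (fun _ : ι => ℂ) 2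

/-- The standard orthonormal basis of `ℓ²(ι)`. -/
def stdBasis (ι : Type) : HilbertBasis ι ℂ (L2 ι) := ⟨LinearIsometryEquiv.refl ℂ _⟩

theorem stdBasis_apply {ι : Type} [DecidableEq ι] (i : ι) :
    stdBasis ι i = lp.single 2 i (1 : ℂ) := by
  rw [← HilbertBasis.repr_symm_single]; rfl

variable {ι κ : Type} {H K : Type*}
  [NormedAddCommGroup H] [InnerProductSpace ℂ H] [CompleteSpace H]
  [NormedAddCommGroup K] [InnerProductSpace ℂ K] [CompleteSpace K]

theorem basis_ext (b : HilbertBasis ι ℂ H) {M : Type*} [NormedAddCommGroup M] [NormedSpace ℂ M]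
    {f g : H →L[ℂ] M} (h : ∀ i, f (b i) = g (b i)) : f = g := by
  refine ContinuousLinearMap.ext_on
    (s := Set.range b) ?_ ?_
  · rw [dense_iff_closure_eq, ← Submodule.topologicalClosure_coe, b.dense_span]; rfl
  · rintro _ ⟨i, rfl⟩
    exact h i

theorem orthonormal_tmulL (b : HilbertBasis ι ℂ H) (c : HilbertBasis κ ℂ K) :
    Orthonormal ℂ (fun p : ι × κ => tmulL H K (b p.1) (c p.2)) := by
  classical
  rw [orthonormal_iff_ite]
  rintro ⟨i, j⟩ ⟨i', j'⟩
  rw [inner_tmulL, orthonormal_iff_ite.1 b.orthonormal, orthonormal_iff_ite.1 c.orthonormal]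
  by_cases h1 : i = i' <;> by_cases h2 : j = j' <;> simp [h1, h2]

theorem dense_span_tmulL (b : HilbertBasis ι ℂ H) (c : HilbertBasis κ ℂ K) :
    ⊤ ≤ (Submodule.span ℂ
      (Set.range fun p : ι × κ => tmulL H K (b p.1) (c p.2))).topologicalClosure := by
  set V := (Submodule.span ℂ
      (Set.range fun p : ι × κ => tmulL H K (b p.1) (c p.2))).topologicalClosure with hV
  have hVc : IsClosed (V : Set (HTensor H K)) := Submodule.isClosed_topologicalClosure _
  have h1 : ∀ i k, tmulL H K (b i) k ∈ V := by
    intro i k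
    have : k ∈ (Submodule.span ℂ (Set.range c)).topologicalClosure := by
      rw [c.dense_span]; trivial
    have h2 : (Submodule.span ℂ (Set.range c)).topologicalClosure ≤
        V.comap (tmulL H K (b i)).toLinearMap := by
      refine Submodule.topologicalClosure_minimal _ ?_
        (hVc.preimage (tmulL H K (b i)).continuous)
      rw [Submodule.span_le]
      rintro _ ⟨j, rfl⟩
      exact Submodule.le_topologicalClosure _ (Submodule.subset_span ⟨(i, j), rfl⟩)
    exact h2 this
  have h2 : ∀ h k, tmulL H K h k ∈ V := by
    intro h k
    have : h ∈ (Submodule.span ℂ (Set.range b)).topologicalClosure := by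
      rw [b.dense_span]; trivial
    have h2 : (Submodule.span ℂ (Set.range b)).topologicalClosure ≤
        V.comap ((tmulL H K).flip k).toLinearMap := by
      refine Submodule.topologicalClosure_minimal _ ?_
        (hVc.preimage ((tmulL H K).flip k).continuous)
      rw [Submodule.span_le]
      rintro _ ⟨i, rfl⟩
      exact h1 i k
    exact h2 this
  intro x _
  have h3 : Submodule.span ℂ {z | ∃ h k, tmulL H K h k = z} ≤ V :=
    Submodule.span_le.2 (by rintro _ ⟨h, k, rfl⟩; exact h2 h k)
  exact closure_minimal h3 hVc (dense_tmulL x)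

/-- The orthonormal basis `(b i ⊗ c j)` of the Hilbert tensor product, reindexed along `e`. -/
def tensorBasis {α : Type} (e : α ≃ ι × κ) (b : HilbertBasis ι ℂ H) (c : HilbertBasis κ ℂ K) :
    HilbertBasis α ℂ (HTensor H K) :=
  HilbertBasis.mk (v := fun a => tmulL H K (b (e a).1) (c (e a).2))
    ((orthonormal_tmulL b c).comp e e.injective) (by
      have := dense_span_tmulL b c
      rwa [← e.surjective.range_comp] at this)

theorem tensorBasis_apply {α : Type} (e : α ≃ ι × κ) (b : HilbertBasis ι ℂ H)
    (c : HilbertBasis κ ℂ K) (a : α) :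
    tensorBasis e b c a = tmulL H K (b (e a).1) (c (e a).2) := by
  simp [tensorBasis]

end Basis

section Shift

/-- The sequence `(0, f 0, f 1, …)`. -/
def shiftFun (f : ℕ → ℂ) : ℕ → ℂ
  | 0 => 0
  | n + 1 => f n

theorem hasSum_shiftFun {f : ℕ → ℂ} {s : ℝ} (h : HasSum (fun n => ‖f n‖ ^ (2 : ENNReal).toReal) s) :
    HasSum (fun n => ‖shiftFun f n‖ ^ (2 : ENNReal).toReal) s := by
  rw [← hasSum_nat_add_iff' 1]
  simpa [shiftFun] using h

theorem hasSum_norm (f : L2 ℕ) :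
    HasSum (fun n => ‖f n‖ ^ (2 : ENNReal).toReal) (‖f‖ ^ (2 : ENNReal).toReal) :=
  lp.hasSum_norm (by norm_num) f

/-- The unilateral right shift `T` on `ℓ²(ℕ)`. -/
def shift : L2 ℕ →L[ℂ] L2 ℕ :=
  LinearMap.mkContinuous
    { toFun := fun f => ⟨shiftFun f, memℓp_gen (hasSum_shiftFun (hasSum_norm f)).summable⟩
      map_add' := fun f g => by
        ext n
        cases n with
        | zero => exact (add_zero (0 : ℂ)).symm
        | succ n => rfl
      map_smul' := fun c f => by ext n; cases n <;> simp [shiftFun] } 1 (fun f => by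
    rw [one_mul]
    refine le_of_eq ?_
    rw [lp.norm_eq_tsum_rpow (by norm_num) f, lp.norm_eq_tsum_rpow (by norm_num)]
    congr 1
    exact (hasSum_shiftFun (hasSum_norm f)).tsum_eq.trans (hasSum_norm f).tsum_eq.symm)

theorem shift_apply_zero (f : L2 ℕ) : shift f 0 = 0 := rfl

theorem shift_apply_succ (f : L2 ℕ) (n : ℕ) : shift f (n + 1) = f n := rfl

theorem shift_stdBasis (n : ℕ) : shift (stdBasis ℕ n) = stdBasis ℕ (n + 1) := by
  ext k
  rw [stdBasis_apply, stdBasis_apply]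
  cases k with
  | zero => simp [shift_apply_zero]
  | succ k => simp [shift_apply_succ, Pi.single_apply]

theorem star_shift_mul_shift : star shift * shift = 1 := by
  ext1 f
  refine ext_inner_left ℂ fun g => ?_
  rw [mul_apply_eq_comp, ContinuousLinearMap.star_eq_adjoint,
    ContinuousLinearMap.adjoint_inner_right, one_apply_eq_self,
    lp.inner_eq_tsum, lp.inner_eq_tsum, (lp.summable_inner (𝕜 := ℂ) (shift g) (shift f)).tsum_eq_zero_add]
  simp [shift_apply_zero, shift_apply_succ]

/-- The Toeplitz algebra: the norm closed unital `*`-algebra generated by the shift. -/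
def Toeplitz : StarSubalgebra ℂ (L2 ℕ →L[ℂ] L2 ℕ) := StarAlgebra.elemental ℂ shift

instance isClosed_toeplitz : IsClosed (Toeplitz : Set (L2 ℕ →L[ℂ] L2 ℕ)) :=
  StarAlgebra.elemental.isClosed ℂ shift

instance : Ring Toeplitz := inferInstance
instance : Monoid Toeplitz := inferInstance
instance : Algebra ℂ Toeplitz := inferInstance

/-- The shift as an element of the Toeplitz algebra. -/
def genT : Toeplitz := ⟨shift, StarAlgebra.elemental.self_mem ℂ shift⟩

/-- The operators `T_{n,m} = Tⁿ (T*)ᵐ`. -/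
def opT (n m : ℕ) : Toeplitz := genT ^ n * star genT ^ m

end Shift

section Comult

/-- The bijection `(i, j) ↦ (i - j, min i j)`. -/
def diagEquiv : ℕ × ℕ ≃ ℤ × ℕ where
  toFun p := ((p.1 : ℤ) - p.2, min p.1 p.2)
  invFun q := (q.2 + q.1.toNat, q.2 + (-q.1).toNat)
  left_inv p := by
    ext
    · simp only; omega
    · simp only; omega
  right_inv q := by
    ext
    · simp only; omega
    · simp only; omega

/-- The unitary `ℓ²(ℕ) ⊗ ℓ²(ℕ) → ℓ²(ℤ) ⊗ ℓ²(ℕ)` with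
`e i ⊗ e j ↦ e (i - j) ⊗ e (min i j)`. -/
def diagUnitary : HTensor (L2 ℕ) (L2 ℕ) ≃ₗᵢ[ℂ] HTensor (L2 ℤ) (L2 ℕ) :=
  (tensorBasis (Equiv.refl _) (stdBasis ℕ) (stdBasis ℕ)).repr.trans
    (tensorBasis diagEquiv (stdBasis ℤ) (stdBasis ℕ)).repr.symm

theorem diagUnitary_apply (i j : ℕ) :
    diagUnitary (tmulL _ _ (stdBasis ℕ i) (stdBasis ℕ j)) =
      tmulL _ _ (stdBasis ℤ ((i : ℤ) - j)) (stdBasis ℕ (min i j)) := by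
  have h1 : tmulL _ _ (stdBasis ℕ i) (stdBasis ℕ j) =
    tensorBasis (Equiv.refl _) (stdBasis ℕ) (stdBasis ℕ) (i, j) := by
      rw [tensorBasis_apply]; rfl
  rw [h1, diagUnitary, LinearIsometryEquiv.trans_apply, HilbertBasis.repr_self,
    HilbertBasis.repr_symm_single, tensorBasis_apply]
  rfl

/-- The amplification `A ↦ 1 ⊗ A`. -/
def amplify : (L2 ℕ →L[ℂ] L2 ℕ) →⋆ₐ[ℂ] (HTensor (L2 ℤ) (L2 ℕ) →L[ℂ] HTensor (L2 ℤ) (L2 ℕ)) where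
  toFun A := tensorOp 1 A
  map_one' := tensorOp_one
  map_mul' A B := by rw [tensorOp_mul, one_mul]
  map_zero' := htensor_ext fun h k => by simp
  map_add' A B := htensor_ext fun h k => by simp
  commutes' c := htensor_ext fun h k => by simp [Algebra.algebraMap_eq_smul_one]
  map_star' A := by rw [tensorOp_star, star_one]

/-- The `*`-homomorphism `A ↦ U* (1 ⊗ A) U`, where `U` is the above unitary. -/
def comulFull : (L2 ℕ →L[ℂ] L2 ℕ) →⋆ₐ[ℂ]
    (HTensor (L2 ℕ) (L2 ℕ) →L[ℂ] HTensor (L2 ℕ) (L2 ℕ)) where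
  toFun A := diagUnitary.symm.conjStarAlgEquiv (amplify A)
  map_one' := by rw [map_one, map_one]
  map_mul' A B := by rw [map_mul, map_mul]
  map_zero' := by rw [map_zero, map_zero]
  map_add' A B := by rw [map_add, map_add]
  commutes' c := by rw [AlgHomClass.commutes, AlgEquivClass.commutes]
  map_star' A := by rw [map_star, map_star]

theorem comulFull_shift : comulFull shift = tensorOp shift shift := by
  refine basis_ext (tensorBasis (Equiv.refl _) (stdBasis ℕ) (stdBasis ℕ)) ?_
  rintro ⟨i, j⟩
  rw [tensorBasis_apply]
  change diagUnitary.symm (tensorOp 1 shift (diagUnitary (tmulL _ _ (stdBasis ℕ i) (stdBasis ℕ j))))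
    = tensorOp shift shift (tmulL _ _ (stdBasis ℕ i) (stdBasis ℕ j))
  rw [diagUnitary_apply, tensorOp_tmulL, tensorOp_tmulL, LinearIsometryEquiv.symm_apply_eq,
    shift_stdBasis, shift_stdBasis, shift_stdBasis, diagUnitary_apply,
    one_apply_eq_self]
  congr 3 <;> [push_cast; skip] <;> [ring; omega]

theorem comulFull_mem (A : Toeplitz) : comulFull A ∈ minTensor Toeplitz Toeplitz := by
  have hc : Continuous comulFull :=
    AddMonoidHomClass.continuous_of_bound comulFull 1 fun x => by
      rw [one_mul]; exact NonUnitalStarAlgHom.norm_apply_le comulFull x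
  have h1 : StarAlgebra.adjoin ℂ {shift} ≤
      (minTensor Toeplitz Toeplitz).comap comulFull := by
    rw [StarAlgebra.adjoin_le_iff]
    rintro _ rfl
    change comulFull shift ∈ minTensor Toeplitz Toeplitz
    rw [comulFull_shift]
    exact tensorOp_mem genT.2 genT.2
  exact closure_minimal h1 ((isClosed_minTensor Toeplitz Toeplitz).preimage hc) A.2

/-- The comultiplication of the Toeplitz algebra: the unital `*`-homomorphism `Δ : 𝒯 → 𝒯 ⊗ 𝒯`
with `Δ(T) = T ⊗ T` (a `*`-homomorphism on `𝒯` is determined by its value at `T`). -/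
def comul : Toeplitz →⋆ₐ[ℂ] minTensor Toeplitz Toeplitz :=
  StarAlgHom.codRestrict (comulFull.comp Toeplitz.subtype) _ comulFull_mem

theorem comul_genT : comul genT = elemTensor genT genT := Subtype.ext comulFull_shift

theorem star_genT_mul_genT : star genT * genT = 1 := Subtype.ext star_shift_mul_shift

theorem star_genT_pow_mul (m : ℕ) : star genT ^ m * genT ^ m = 1 := by
  induction m with
  | zero => simp
  | succ m ih =>
    rw [pow_succ, pow_succ' genT, mul_assoc, ← mul_assoc (star genT), star_genT_mul_genT, one_mul,
      ih]

theorem comul_opT (n m : ℕ) : comul (opT n m) = elemTensor (opT n m) (opT n m) := by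
  have hmul : ∀ a b a' b' : Toeplitz,
      elemTensor a b * elemTensor a' b' = elemTensor (a * a') (b * b') :=
    fun a b a' b' => Subtype.ext (tensorOp_mul _ _ _ _)
  have hone : elemTensor (1 : Toeplitz) (1 : Toeplitz) = 1 := Subtype.ext tensorOp_one
  have hpow : ∀ (a b : Toeplitz) (k : ℕ), elemTensor a b ^ k = elemTensor (a ^ k) (b ^ k) := by
    intro a b k
    induction k with
    | zero => simp only [pow_zero, hone]
    | succ k ih => rw [pow_succ, ih, hmul, pow_succ, pow_succ]
  have hstar : star (elemTensor genT genT) = elemTensor (star genT) (star genT) :=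
    Subtype.ext (tensorOp_star _ _)
  rw [opT, map_mul, map_pow, map_pow, map_star, comul_genT, hstar, hpow, hpow, hmul]

/-- The comultiplication as a continuous linear map. -/
def comulL : Toeplitz →L[ℂ] minTensor Toeplitz Toeplitz :=
  LinearMap.mkContinuous comul.toAlgHom.toLinearMap 1 fun x => by
    rw [one_mul]; exact NonUnitalStarAlgHom.norm_apply_le comul x

theorem comulL_apply (A : Toeplitz) : comulL A = comul A := rfl

theorem norm_comulL_le : ‖comulL‖ ≤ 1 := LinearMap.mkContinuous_norm_le _ zero_le_one _

end Comult

section Dual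

theorem opT_mul_opT (n m k l : ℕ) : ∃ p q, opT n m * opT k l = opT p q := by
  rcases le_total m k with h | h
  · obtain ⟨d, rfl⟩ := Nat.exists_eq_add_of_le h
    refine ⟨n + d, l, ?_⟩
    rw [opT, opT, opT, pow_add genT m d, mul_assoc, mul_assoc, ← mul_assoc (star genT ^ m),
      star_genT_pow_mul, one_mul, pow_add, mul_assoc]
  · obtain ⟨d, rfl⟩ := Nat.exists_eq_add_of_le' h
    refine ⟨n, d + l, ?_⟩
    rw [opT, opT, opT, pow_add _ d k, mul_assoc, mul_assoc, ← mul_assoc (star genT ^ k),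
      star_genT_pow_mul, one_mul, pow_add]

/-- The linear combinations of the `T_{n,m}` are dense in the Toeplitz algebra. -/
theorem dense_span_opT :
    Dense ((Submodule.span ℂ (Set.range fun p : ℕ × ℕ => opT p.1 p.2) : Submodule ℂ Toeplitz) :
      Set Toeplitz) := by
  set W : Submodule ℂ Toeplitz := Submodule.span ℂ (Set.range fun p : ℕ × ℕ => opT p.1 p.2) with hW
  have hmul : ∀ x ∈ W, ∀ y ∈ W, x * y ∈ W := by
    intro x hx y hy
    have := Submodule.mul_mem_mul hx hy
    rw [hW, Submodule.span_mul_span] at this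
    refine Submodule.span_mono ?_ this
    rintro _ ⟨_, ⟨⟨n, m⟩, rfl⟩, _, ⟨⟨k, l⟩, rfl⟩, rfl⟩
    obtain ⟨p, q, h⟩ := opT_mul_opT n m k l
    exact ⟨(p, q), h.symm⟩
  have hle : ∀ x ∈ StarAlgebra.adjoin ℂ {shift}, ∃ y ∈ W, (y : L2 ℕ →L[ℂ] L2 ℕ) = x := by
    intro x hx
    rw [← StarSubalgebra.mem_toSubalgebra, StarAlgebra.adjoin_toSubalgebra] at hx
    induction hx using Algebra.adjoin_induction with
    | mem x hx =>
      rcases hx with hx | hx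
      · obtain rfl : x = shift := hx
        exact ⟨opT 1 0, Submodule.subset_span ⟨(1, 0), rfl⟩, by simp [opT, genT]⟩
      · obtain hx : star x = shift := hx
        refine ⟨opT 0 1, Submodule.subset_span ⟨(0, 1), rfl⟩, ?_⟩
        rw [← star_star x, hx]
        simp [opT, genT]
    | algebraMap r =>
      refine ⟨r • opT 0 0, W.smul_mem _ (Submodule.subset_span ⟨(0, 0), rfl⟩), ?_⟩
      rw [Algebra.algebraMap_eq_smul_one]
      simp [opT]
    | add x y _ _ hx hy =>
      obtain ⟨x', hx', rfl⟩ := hx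
      obtain ⟨y', hy', rfl⟩ := hy
      exact ⟨x' + y', W.add_mem hx' hy', rfl⟩
    | mul x y _ _ hx hy =>
      obtain ⟨x', hx', rfl⟩ := hx
      obtain ⟨y', hy', rfl⟩ := hy
      exact ⟨x' * y', hmul _ hx' _ hy', rfl⟩
  intro A
  rw [closure_subtype]
  refine closure_mono ?_ A.2
  intro x hx
  obtain ⟨y, hy, rfl⟩ := hle x hx
  exact ⟨y, hy, rfl⟩

theorem dual_ext {ρ φ : StrongDual ℂ Toeplitz} (h : ∀ n m, ρ (opT n m) = φ (opT n m)) : ρ = φ := by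
  refine ContinuousLinearMap.ext_on dense_span_opT ?_
  rintro _ ⟨⟨n, m⟩, rfl⟩
  exact h n m

/-- The convolution `(ρ * φ)(A) = (ρ ⊗ φ)(Δ A)` on the dual of the Toeplitz algebra. -/
def conv (ρ φ : StrongDual ℂ Toeplitz) : StrongDual ℂ Toeplitz := tensorDual ρ φ ∘L comulL

theorem conv_opT (ρ φ : StrongDual ℂ Toeplitz) (n m : ℕ) :
    conv ρ φ (opT n m) = ρ (opT n m) * φ (opT n m) := by
  rw [conv, ContinuousLinearMap.comp_apply, comulL_apply, comul_opT, tensorDual_elemTensor]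

/-- The dual of the Toeplitz algebra, with its dual norm and the product `(ρ * φ)(A) = (ρ ⊗ φ)(Δ A)`,
is a commutative Banach algebra. -/
instance : NonUnitalNormedCommRing (StrongDual ℂ Toeplitz) where
  __ := (inferInstance : NormedAddCommGroup (StrongDual ℂ Toeplitz))
  mul := conv
  left_distrib ρ φ ψ := dual_ext fun n m =>
    (conv_opT _ _ n m).trans <| (mul_add _ _ _).trans <| Eq.symm <|
      congrArg₂ (· + ·) (conv_opT _ _ n m) (conv_opT _ _ n m)
  right_distrib ρ φ ψ := dual_ext fun n m =>
    (conv_opT _ _ n m).trans <| (add_mul _ _ _).trans <| Eq.symm <|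
      congrArg₂ (· + ·) (conv_opT _ _ n m) (conv_opT _ _ n m)
  zero_mul ρ := dual_ext fun n m => (conv_opT _ _ n m).trans (zero_mul _)
  mul_zero ρ := dual_ext fun n m => (conv_opT _ _ n m).trans (mul_zero _)
  mul_assoc ρ φ ψ := dual_ext fun n m => by
    change conv (conv ρ φ) ψ _ = conv ρ (conv φ ψ) _
    rw [conv_opT, conv_opT, conv_opT, conv_opT, mul_assoc]
  mul_comm ρ φ := dual_ext fun n m => by
    change conv ρ φ _ = conv φ ρ _
    rw [conv_opT, conv_opT, mul_comm]
  norm_mul_le ρ φ := by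
    change ‖conv ρ φ‖ ≤ _
    refine (ContinuousLinearMap.opNorm_comp_le _ _).trans ?_
    exact (mul_le_of_le_one_right (norm_nonneg _) norm_comulL_le).trans (norm_tensorDual_le ρ φ)

theorem dual_mul_apply (ρ φ : StrongDual ℂ Toeplitz) (A : Toeplitz) :
    (ρ * φ) A = tensorDual ρ φ (comul A) := rfl

instance : IsScalarTower ℂ (StrongDual ℂ Toeplitz) (StrongDual ℂ Toeplitz) where
  smul_assoc c ρ φ := dual_ext fun n m => by
    change conv (c • ρ) φ _ = c * conv ρ φ _
    rw [conv_opT, conv_opT, ← mul_assoc]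
    rfl

instance : SMulCommClass ℂ (StrongDual ℂ Toeplitz) (StrongDual ℂ Toeplitz) where
  smul_comm c ρ φ := dual_ext fun n m => by
    change c * conv ρ φ _ = conv ρ (c • φ) _
    rw [conv_opT, conv_opT, mul_left_comm]
    rfl

/-- The ideal `𝒦` of the compact operators in the Toeplitz algebra. -/
def compactIdeal : Submodule ℂ Toeplitz where
  carrier := {A | IsCompactOperator (A : L2 ℕ →L[ℂ] L2 ℕ)}
  zero_mem' := isCompactOperator_zero
  add_mem' hA hB := hA.add hB
  smul_mem' c _ hA := hA.smul c

theorem mem_compactIdeal {A : Toeplitz} :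
    A ∈ compactIdeal ↔ IsCompactOperator (A : L2 ℕ →L[ℂ] L2 ℕ) := Iff.rfl

end Dual


end ToeplitzQSG

end

open ToeplitzQSG

/-
Realise `ℓ²(ℕ)` inside `ℓ²(ℤ)`, where `C(S¹)` acts isometrically by Laurent operators `π(f)`, and
let `T_f` be the compression of `π(f)` to `ℓ²(ℕ)`. The functions `g` such that `T_{fg} - T_f T_g` is
compact for all `f` form a closed algebra, which contains the coordinate `z` because `1 - T T*` has
rank one, and `z̄` because the shift extends to `ℓ²(ℤ)`; by Stone–Weierstrass every `g` is of this
kind. Thus `f ↦ [T_f]` is a homomorphism from `C(S¹)` to `𝒯/𝒦`. It is isometric: translates of a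
vector of `ℓ²(ℤ)` far to the right see `T_f` as `π(f)` and are annihilated in the limit by a compact
operator, so `‖f‖ ≤ ‖T_f + K‖`. Its closed range contains every `[T_{n,m}]`, so it is onto, and the
symbol map is its inverse composed with `𝒯 → 𝒯/𝒦`. The counit is the symbol at `1`; the identities
it satisfies hold on the `T_{n,m}`, which span a dense subspace.
-/

noncomputable section

namespace ToeplitzQSG

open Filter Topology InnerProductSpace

section Convergence

variable {𝕜 ι E F G : Type*} [RCLike 𝕜] [NormedAddCommGroup E] [NormedSpace 𝕜 E]
  [NormedAddCommGroup F] [NormedSpace 𝕜 F] [NormedAddCommGroup G] [NormedSpace 𝕜 G]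
  {l : Filter ι} {S : ι → E →L[𝕜] F} {C : ℝ}

theorem equicontinuous_of_norm_le (hS : ∀ i, ‖S i‖ ≤ C) : Equicontinuous fun i => ⇑(S i) :=
  ((NormedSpace.equicontinuous_TFAE S).out 1 5).2 (Exists.intro C hS)

theorem isClosed_setOfPred_tendsto_apply (hS : ∀ i, ‖S i‖ ≤ C) (S' : E →L[𝕜] F) :
    IsClosed {x | Tendsto (fun i => S i x) l (𝓝 (S' x))} :=
  (equicontinuous_of_norm_le hS).isClosed_setOfPred_tendsto S'.continuous

theorem tendsto_apply_of_dense_span (hS : ∀ i, ‖S i‖ ≤ C) {S' : E →L[𝕜] F} {s : Set E}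
    (hs : Dense (Submodule.span 𝕜 s : Set E))
    (h : ∀ x ∈ s, Tendsto (fun i => S i x) l (𝓝 (S' x))) (x : E) :
    Tendsto (fun i => S i x) l (𝓝 (S' x)) := by
  refine (isClosed_setOfPred_tendsto_apply hS S').closure_subset_iff.2 (fun y hy => ?_) (hs x)
  induction hy using Submodule.span_induction with
  | mem y hy => exact h y hy
  | zero => simpa using tendsto_const_nhds
  | add y z _ _ hy hz => simpa using hy.add hz
  | smul c y _ hy => simpa using hy.const_smul c

theorem tendsto_comp_of_isCompactOperator (hS : ∀ i, ‖S i‖ ≤ C) {S' : E →L[𝕜] F}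
    (h : ∀ x, Tendsto (fun i => S i x) l (𝓝 (S' x))) {K : G →L[𝕜] E} (hK : IsCompactOperator K) :
    Tendsto (fun i => S i ∘L K) l (𝓝 (S' ∘L K)) := by
  set B := closure (K '' Metric.closedBall 0 1)
  have hunif : TendstoUniformlyOn (fun i => ⇑(S i)) S' l B := by
    refine UniformOnFun.tendsto_iff_tendstoUniformlyOn.1
      ((EquicontinuousOn.tendsto_uniformOnFun_iff_pi' (𝔖 := {B}) ?_ ?_ l S').2 ?_) B rfl
    · rintro _ rfl
      exact hK.isCompact_closure_image_closedBall 1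
    · exact fun _ _ => (equicontinuous_of_norm_le hS).equicontinuousOn _
    · exact tendsto_pi_nhds.2 fun x => h x
  refine Metric.tendsto_nhds.2 fun ε hε => ?_
  filter_upwards [Metric.tendstoUniformlyOn_iff.1 hunif (ε / 2) (half_pos hε)] with i hi
  refine lt_of_le_of_lt ?_ (half_lt_self hε)
  rw [dist_eq_norm]
  refine ContinuousLinearMap.opNorm_le_of_unit_norm (𝕜 := 𝕜) (half_pos hε).le fun x hx => ?_
  rw [← ContinuousLinearMap.sub_comp, ContinuousLinearMap.comp_apply, _root_.sub_apply,
    ← dist_eq_norm, dist_comm]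
  exact (hi (K x) (subset_closure ⟨x, by simp [hx], rfl⟩)).le

end Convergence

section HilbertBasis

variable {𝕜 ι κ H : Type*} [RCLike 𝕜] [NormedAddCommGroup H] [InnerProductSpace 𝕜 H]

theorem isCompactOperator_rankOne (x y : H) : IsCompactOperator (rankOne 𝕜 x y) :=
  (isCompactOperator_of_locallyCompactSpace_dom (innerSL 𝕜 y)).clm_comp
    (ContinuousLinearMap.toSpanSingleton 𝕜 x)

variable (b : HilbertBasis ι 𝕜 H)

theorem tendsto_sum_rankOne (y : H) :
    Tendsto (fun s : Finset ι => (∑ i ∈ s, rankOne 𝕜 (b i) (b i)) y) atTop (𝓝 y) := by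
  simpa [HasSum, b.repr_apply_apply] using b.hasSum_repr y

theorem norm_sum_rankOne_le (s : Finset ι) : ‖∑ i ∈ s, rankOne 𝕜 (b i) (b i)‖ ≤ 1 := by
  refine ContinuousLinearMap.opNorm_le_bound _ zero_le_one fun y => ?_
  have hnorm : ‖∑ i ∈ s, ⟪b i, y⟫_𝕜 • b i‖ ^ 2 = ∑ i ∈ s, ‖⟪b i, y⟫_𝕜‖ ^ 2 := by
    have h := inner_self_eq_norm_sq_to_K (𝕜 := 𝕜) (∑ i ∈ s, ⟪b i, y⟫_𝕜 • b i)
    rw [b.orthonormal.inner_sum] at h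
    apply RCLike.ofReal_injective (K := 𝕜)
    push_cast
    exact h.symm.trans (Finset.sum_congr rfl fun i _ => RCLike.conj_mul _)
  rw [one_mul, ← sq_le_sq₀ (norm_nonneg _) (norm_nonneg _)]
  simpa only [_root_.sum_apply, rankOne_apply, hnorm] using
    b.orthonormal.sum_inner_products_le y (s := s)

variable [CompleteSpace H]

theorem mem_of_isCompactOperator {V : Submodule 𝕜 (H →L[𝕜] H)}
    (hV : IsClosed (V : Set (H →L[𝕜] H))) (h : ∀ i j, rankOne 𝕜 (b i) (b j) ∈ V)
    {K : H →L[𝕜] H} (hK : IsCompactOperator K) : K ∈ V := by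
  have hrow : ∀ i y, rankOne 𝕜 (b i) y ∈ V := by
    intro i y
    refine hV.mem_of_tendsto (((rankOne 𝕜 (b i)).continuous.tendsto y).comp
      (tendsto_sum_rankOne b y)) (Eventually.of_forall fun s => ?_)
    simp only [Function.comp, _root_.sum_apply, rankOne_apply, map_sum, map_smulₛₗ]
    exact sum_mem fun j _ => V.smul_mem _ (h i j)
  have htrunc : Tendsto (fun s : Finset ι => (∑ i ∈ s, rankOne 𝕜 (b i) (b i)) ∘L K) atTop (𝓝 K) :=
    tendsto_comp_of_isCompactOperator (S' := .id 𝕜 H) (norm_sum_rankOne_le b)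
      (tendsto_sum_rankOne b) hK
  refine hV.mem_of_tendsto htrunc (Eventually.of_forall fun s => ?_)
  rw [ContinuousLinearMap.finsetSum_comp]
  exact sum_mem fun i _ => by rw [rankOne_comp]; exact hrow _ _

theorem tendsto_apply_zero_of_isCompactOperator {l : Filter κ} {x : κ → H} {C : ℝ}
    (hx : ∀ k, ‖x k‖ ≤ C) (hweak : ∀ i, Tendsto (fun k => ⟪b i, x k⟫_𝕜) l (𝓝 0))
    {K : H →L[𝕜] H} (hK : IsCompactOperator K) : Tendsto (fun k => K (x k)) l (𝓝 0) := by
  let V : Submodule 𝕜 (H →L[𝕜] H) :=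
    { carrier := {A | Tendsto (fun k => A (x k)) l (𝓝 0)}
      add_mem' := fun hA hB => by simpa using Tendsto.add hA hB
      zero_mem' := by simpa using tendsto_const_nhds
      smul_mem' := fun c A hA => by simpa using Tendsto.const_smul hA c }
  have hV : IsClosed (V : Set (H →L[𝕜] H)) :=
    isClosed_setOfPred_tendsto_apply (S := fun k => ContinuousLinearMap.apply 𝕜 H (x k))
      (C := C) (fun k => (ContinuousLinearMap.opNorm_le_bound _ (norm_nonneg _) fun A =>
        (A.le_opNorm (x k)).trans_eq (mul_comm _ _)).trans (hx k)) 0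
  refine mem_of_isCompactOperator b hV (fun i j => ?_) hK
  simpa [V] using (hweak j).smul_const (b i)

/-- The unitary operator that permutes the vectors of a Hilbert basis. -/
def permUnitary (σ : Equiv.Perm ι) : H ≃ₗᵢ[𝕜] H :=
  b.repr.trans (HilbertBasis.mk (b.orthonormal.comp σ σ.injective) (by
    rw [σ.surjective.range_comp]; exact b.dense_span.ge)).repr.symm

theorem permUnitary_apply (σ : Equiv.Perm ι) (i : ι) : permUnitary b σ (b i) = b (σ i) := by
  classical
  rw [permUnitary, LinearIsometryEquiv.trans_apply, HilbertBasis.repr_self,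
    HilbertBasis.repr_symm_single, HilbertBasis.coe_mk, Function.comp_apply]

end HilbertBasis

section StoneWeierstrass

variable {𝕜 X : Type*} [RCLike 𝕜] [TopologicalSpace X] [CompactSpace X]

theorem subalgebra_eq_top_of_injective (M : Subalgebra 𝕜 C(X, 𝕜))
    (hM : IsClosed (M : Set C(X, 𝕜))) {f : C(X, 𝕜)} (hf : Function.Injective f) (hfM : f ∈ M)
    (hfM' : star f ∈ M) : M = ⊤ := by
  have hle : (StarAlgebra.adjoin 𝕜 {f}).toSubalgebra ≤ M := by
    rw [StarAlgebra.adjoin_toSubalgebra, Algebra.adjoin_le_iff]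
    rintro g (rfl | hg)
    · exact hfM
    · rw [Set.mem_star, Set.mem_singleton_iff] at hg
      rwa [← star_star g, hg]
  have hsep : (StarAlgebra.adjoin 𝕜 {f}).SeparatesPoints := fun x y hxy =>
    ⟨f, ⟨f, StarAlgebra.self_mem_adjoin_singleton 𝕜 f, rfl⟩, hf.ne hxy⟩
  have htop := ContinuousMap.starSubalgebra_topologicalClosure_eq_top_of_separatesPoints _ hsep
  refine eq_top_iff.2 fun g _ => hM.closure_subset_iff.2 hle ?_
  change g ∈ (StarAlgebra.adjoin 𝕜 {f}).topologicalClosure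
  rw [htop]
  trivial

end StoneWeierstrass

section CircleCalculus

/-- The coordinate function `z` on the unit circle. -/
def circleCoord : C(Circle, ℂ) := ⟨(↑), by fun_prop⟩

theorem circleCoord_injective : Function.Injective circleCoord := Subtype.val_injective

theorem circleCoord_mul_star : circleCoord * star circleCoord = 1 := by
  ext z
  exact (Complex.mul_conj z).trans (by simp)

variable {A : Type*} [CStarAlgebra A]

/-- The continuous functional calculus `f ↦ f(u)` of a unitary element `u`, for functions on the
whole unit circle instead of the spectrum of `u`. -/
def circleCalculus (u : unitary A) : C(Circle, ℂ) →⋆ₐ[ℂ] A :=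
  (cfcHom (R := ℂ) (Unitary.coe_isStarNormal u)).comp
    (ContinuousMap.compStarAlgHom' ℂ ℂ
      ⟨fun w => (⟨w.1, Unitary.spectrum_subset_circle u w.2⟩ : Circle),
        continuous_subtype_val.subtype_mk _⟩)

theorem circleCalculus_circleCoord (u : unitary A) : circleCalculus u circleCoord = u :=
  cfcHom_id (R := ℂ) (Unitary.coe_isStarNormal u)

theorem norm_circleCalculus {u : unitary A} (hu : ∀ z : Circle, (z : ℂ) ∈ spectrum ℂ (u : A))
    (f : C(Circle, ℂ)) : ‖circleCalculus u f‖ = ‖f‖ := by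
  refine NonUnitalStarAlgHom.norm_map _ ?_ f
  refine (cfcHom_injective (R := ℂ) (Unitary.coe_isStarNormal u)).comp fun g₁ g₂ h => ?_
  ext z
  exact DFunLike.congr_fun h ⟨z, hu z⟩

end CircleCalculus

section Shifts

theorem inner_stdBasis {ι : Type} (i : ι) (x : L2 ι) : ⟪stdBasis ι i, x⟫_ℂ = x i := by
  classical
  rw [stdBasis_apply, lp.inner_single_left]
  simp

theorem star_shift_apply (x : L2 ℕ) (n : ℕ) : star shift x n = x (n + 1) := by
  rw [← inner_stdBasis, ← inner_stdBasis, ContinuousLinearMap.star_eq_adjoint,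
    ContinuousLinearMap.adjoint_inner_right, shift_stdBasis]

theorem one_sub_shift_mul_star :
    1 - shift * star shift = rankOne ℂ (stdBasis ℕ 0) (stdBasis ℕ 0) := by
  ext x n
  change x n - shift (star shift x) n = (⟪stdBasis ℕ 0, x⟫_ℂ • stdBasis ℕ 0) n
  rw [inner_stdBasis, stdBasis_apply]
  cases n with
  | zero => simp [shift_apply_zero]
  | succ n => simp [shift_apply_succ, star_shift_apply]

theorem shift_pow_stdBasis_zero (n : ℕ) : (shift ^ n) (stdBasis ℕ 0) = stdBasis ℕ n := by
  induction n with
  | zero => rfl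
  | succ n ih => rw [pow_succ', mul_apply_eq_comp, ih, shift_stdBasis]

theorem coe_opT (n m : ℕ) : (opT n m : L2 ℕ →L[ℂ] L2 ℕ) = shift ^ n * star shift ^ m := rfl

theorem opT_sub_opT_succ (n m : ℕ) :
    (opT n m - opT (n + 1) (m + 1) : L2 ℕ →L[ℂ] L2 ℕ) =
      rankOne ℂ (stdBasis ℕ n) (stdBasis ℕ m) := by
  have hfactor : (opT n m - opT (n + 1) (m + 1) : L2 ℕ →L[ℂ] L2 ℕ) =
      shift ^ n * ((1 - shift * star shift) * star (shift ^ m)) := by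
    rw [coe_opT, coe_opT, pow_succ shift, pow_succ' (star shift), star_pow]
    noncomm_ring
  rw [hfactor, one_sub_shift_mul_star, ContinuousLinearMap.mul_def, ContinuousLinearMap.mul_def,
    rankOne_comp, comp_rankOne, ContinuousLinearMap.star_eq_adjoint,
    ContinuousLinearMap.adjoint_adjoint, shift_pow_stdBasis_zero, shift_pow_stdBasis_zero]

theorem mem_toeplitz_of_isCompactOperator {K : L2 ℕ →L[ℂ] L2 ℕ} (hK : IsCompactOperator K) :
    K ∈ Toeplitz := by
  refine mem_of_isCompactOperator (V := Toeplitz.toSubalgebra.toSubmodule) (stdBasis ℕ)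
    isClosed_toeplitz (fun n m => ?_) hK
  rw [← opT_sub_opT_succ]
  exact sub_mem (opT n m).2 (opT (n + 1) (m + 1)).2

/-- The bilateral shift `e i ↦ e (i + 1)` on `ℓ²(ℤ)`. -/
def bilateralShift : unitary (L2 ℤ →L[ℂ] L2 ℤ) :=
  Unitary.linearIsometryEquiv.symm (permUnitary (stdBasis ℤ) (Equiv.addRight 1))

theorem bilateralShift_stdBasis (i : ℤ) :
    (bilateralShift : L2 ℤ →L[ℂ] L2 ℤ) (stdBasis ℤ i) = stdBasis ℤ (i + 1) :=
  permUnitary_apply (stdBasis ℤ) _ i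

theorem star_bilateralShift_apply (x : L2 ℤ) (n : ℤ) :
    (star bilateralShift : L2 ℤ →L[ℂ] L2 ℤ) x n = x (n + 1) := by
  rw [← inner_stdBasis, ← inner_stdBasis, ContinuousLinearMap.star_eq_adjoint,
    ContinuousLinearMap.adjoint_inner_right, bilateralShift_stdBasis]

theorem tendsto_coord_cofinite {ι : Type} (x : L2 ι) : Tendsto x cofinite (𝓝 0) := by
  have h : Summable fun i => ‖x i‖ ^ 2 := by
    simpa only [inner_stdBasis] using (stdBasis ι).orthonormal.inner_products_summable x
  exact tendsto_zero_iff_norm_tendsto_zero.2 (by simpa using h.tendsto_cofinite_zero.sqrt)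

theorem apply_eq_zero_of_norm_apply_succ {ι : Type} (x : L2 ι) {e : ℕ → ι}
    (he : Function.Injective e) (h : ∀ n, ‖x (e (n + 1))‖ = ‖x (e n)‖) : x (e 0) = 0 := by
  have hconst : ∀ n, ‖x (e n)‖ = ‖x (e 0)‖ := fun n => by
    induction n with
    | zero => rfl
    | succ n ih => rw [h, ih]
  have hlim : Tendsto (fun n => ‖x (e n)‖) cofinite (𝓝 0) :=
    tendsto_zero_iff_norm_tendsto_zero.1 ((tendsto_coord_cofinite x).comp he.tendsto_cofinite)
  simp only [hconst] at hlim
  exact norm_eq_zero.1 (tendsto_nhds_unique tendsto_const_nhds hlim)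

-- Off `n = 0` the resolvent equation `x (n + 1) - λ x n = δ n 0` makes `|x|` constant on both half
-- lines, so it has no solution in `ℓ²(ℤ)`.
theorem circle_mem_spectrum_star_bilateralShift (z : Circle) :
    (z : ℂ) ∈ spectrum ℂ (star bilateralShift : L2 ℤ →L[ℂ] L2 ℤ) := by
  rw [spectrum.mem_iff]
  intro hunit
  obtain ⟨R, hR⟩ := hunit.exists_right_inv
  set x := R (stdBasis ℤ 0)
  have hrec : ∀ n, z * x n - x (n + 1) = stdBasis ℤ 0 n := fun n => by
    rw [← star_bilateralShift_apply]
    exact congrArg (· n) (DFunLike.congr_fun hR (stdBasis ℤ 0))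
  have hnorm : ∀ n ≠ 0, ‖x (n + 1)‖ = ‖x n‖ := fun n hn => by
    have h := hrec n
    rw [stdBasis_apply, lp.single_apply_ne _ _ _ hn, sub_eq_zero] at h
    rw [← h, norm_mul, Circle.norm_coe, one_mul]
  have hpos : x (0 + 1) = 0 :=
    apply_eq_zero_of_norm_apply_succ x (e := fun n => (n : ℤ) + 1) (fun m n h => by simpa using h)
      fun n => by simpa using hnorm (n + 1) (by omega)
  have hneg : x 0 = 0 :=
    apply_eq_zero_of_norm_apply_succ x (e := fun n => -(n : ℤ)) (fun m n h => by simpa using h)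
      fun n => by simpa using (hnorm (-(n + 1)) (by omega)).symm
  have h := hrec 0
  rw [hpos, hneg] at h
  simp [stdBasis_apply] at h

end Shifts

section Windows

/-- The inclusion of `ℓ²(ℕ)` in `ℓ²(ℤ)`, by which the bilateral shift dilates the shift. -/
def natEmbedding : L2 ℕ →L[ℂ] L2 ℤ :=
  (((stdBasis ℤ).orthonormal.comp ((↑) : ℕ → ℤ)
    Nat.cast_injective).orthogonalFamily.linearIsometry).toContinuousLinearMap

theorem natEmbedding_stdBasis (i : ℕ) : natEmbedding (stdBasis ℕ i) = stdBasis ℤ i := by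
  rw [stdBasis_apply, natEmbedding, LinearIsometry.coe_toContinuousLinearMap,
    OrthogonalFamily.linearIsometry_apply_single]
  simp

theorem adjoint_comp_natEmbedding : natEmbedding.adjoint ∘L natEmbedding = 1 :=
  (ContinuousLinearMap.norm_map_iff_adjoint_comp_self _).1 (LinearIsometry.norm_map _)

theorem norm_natEmbedding_le : ‖natEmbedding‖ ≤ 1 :=
  LinearIsometry.norm_toContinuousLinearMap_le _

theorem norm_adjoint_natEmbedding_le : ‖natEmbedding.adjoint‖ ≤ 1 :=
  (LinearIsometryEquiv.norm_map _ _).trans_le norm_natEmbedding_le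

theorem bilateralShift_comp_natEmbedding :
    (bilateralShift : L2 ℤ →L[ℂ] L2 ℤ) ∘L natEmbedding = natEmbedding ∘L shift := by
  refine basis_ext (stdBasis ℕ) fun i => ?_
  simp only [ContinuousLinearMap.comp_apply, natEmbedding_stdBasis, bilateralShift_stdBasis,
    shift_stdBasis, Nat.cast_succ]

theorem adjoint_natEmbedding_stdBasis (i : ℕ) :
    natEmbedding.adjoint (stdBasis ℤ i) = stdBasis ℕ i := by
  rw [← natEmbedding_stdBasis]
  exact DFunLike.congr_fun adjoint_comp_natEmbedding _

theorem bilateralShift_pow_stdBasis (k : ℕ) (i : ℤ) :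
    (bilateralShift ^ k : L2 ℤ →L[ℂ] L2 ℤ) (stdBasis ℤ i) = stdBasis ℤ (i + k) := by
  induction k with
  | zero => simp
  | succ k ih =>
    rw [pow_succ', mul_apply_eq_comp, ih, bilateralShift_stdBasis, Nat.cast_succ, add_assoc]

theorem star_bilateralShift_pow_mul (k : ℕ) :
    star (bilateralShift ^ k : L2 ℤ →L[ℂ] L2 ℤ) * bilateralShift ^ k = 1 :=
  Unitary.coe_star_mul_self (bilateralShift ^ k)

theorem bilateralShift_pow_mul_star (k : ℕ) :
    (bilateralShift ^ k : L2 ℤ →L[ℂ] L2 ℤ) * star (bilateralShift ^ k) = 1 :=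
  Unitary.coe_mul_star_self (bilateralShift ^ k)

/-- The coordinates of a vector of `ℓ²(ℤ)` from the position `-k` on, as a vector of `ℓ²(ℕ)`. -/
def window (k : ℕ) : L2 ℤ →L[ℂ] L2 ℕ :=
  natEmbedding.adjoint ∘L (bilateralShift ^ k : L2 ℤ →L[ℂ] L2 ℤ)

theorem norm_window_le (k : ℕ) : ‖window k‖ ≤ 1 :=
  ContinuousLinearMap.opNorm_le_bound _ zero_le_one fun x =>
    (ContinuousLinearMap.le_of_opNorm_le _ norm_adjoint_natEmbedding_le _).trans_eq
      (congrArg (1 * ·) (Unitary.norm_map (bilateralShift ^ k) x))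

theorem norm_window_apply_le (k : ℕ) (x : L2 ℤ) : ‖window k x‖ ≤ ‖x‖ :=
  (ContinuousLinearMap.le_of_opNorm_le _ (norm_window_le k) x).trans_eq (one_mul _)

theorem adjoint_window (k : ℕ) :
    (window k).adjoint = star (bilateralShift ^ k : L2 ℤ →L[ℂ] L2 ℤ) ∘L natEmbedding := by
  rw [window, ContinuousLinearMap.adjoint_comp, ContinuousLinearMap.adjoint_adjoint,
    ContinuousLinearMap.star_eq_adjoint]

theorem adjoint_window_stdBasis (k i : ℕ) :
    (window k).adjoint (stdBasis ℕ i) = stdBasis ℤ (i - k) := by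
  rw [adjoint_window, ContinuousLinearMap.comp_apply, natEmbedding_stdBasis,
    ← sub_add_cancel (i : ℤ) k, ← bilateralShift_pow_stdBasis, ← mul_apply_eq_comp,
    star_bilateralShift_pow_mul, sub_add_cancel, one_apply_eq_self]

theorem window_stdBasis {k : ℕ} {i : ℤ} (h : 0 ≤ i + k) :
    window k (stdBasis ℤ i) = stdBasis ℕ (i + k).toNat := by
  rw [window, ContinuousLinearMap.comp_apply, bilateralShift_pow_stdBasis,
    ← adjoint_natEmbedding_stdBasis, Int.toNat_of_nonneg h]

theorem tendsto_adjoint_window_window (x : L2 ℤ) :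
    Tendsto (fun k => (window k).adjoint (window k x)) atTop (𝓝 x) := by
  refine tendsto_apply_of_dense_span (S := fun k => (window k).adjoint ∘L window k) (C := 1)
    (S' := .id ℂ _) (s := Set.range (stdBasis ℤ)) (fun k => ?_)
    (Submodule.dense_iff_topologicalClosure_eq_top.2 (stdBasis ℤ).dense_span) ?_ x
  · rw [ContinuousLinearMap.norm_adjoint_comp_self]
    exact mul_le_one₀ (norm_window_le k) (norm_nonneg _) (norm_window_le k)
  · rintro _ ⟨i, rfl⟩
    refine tendsto_const_nhds.congr' ?_
    filter_upwards [eventually_ge_atTop (-i).toNat] with k hk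
    have h : 0 ≤ i + k := by omega
    rw [ContinuousLinearMap.comp_apply, window_stdBasis h, adjoint_window_stdBasis,
      Int.toNat_of_nonneg h, add_sub_cancel_right, ContinuousLinearMap.id_apply]

theorem tendsto_inner_stdBasis_window (i : ℕ) (x : L2 ℤ) :
    Tendsto (fun k => ⟪stdBasis ℕ i, window k x⟫_ℂ) atTop (𝓝 0) := by
  have hinj : Function.Injective fun k : ℕ => (i - k : ℤ) := fun k l h => by simpa using h
  simp only [← ContinuousLinearMap.adjoint_inner_left, adjoint_window_stdBasis, inner_stdBasis]
  rw [← Nat.cofinite_eq_atTop]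
  exact (tendsto_coord_cofinite x).comp hinj.tendsto_cofinite

end Windows

section ToeplitzOperators

/-- The multiplication operator by a function on the circle, in the Fourier model `ℓ²(ℤ)`. The
coordinate `z` acts as the backward shift because the symbol of `T` is `z⁻¹`. -/
def laurentOp : C(Circle, ℂ) →⋆ₐ[ℂ] (L2 ℤ →L[ℂ] L2 ℤ) := circleCalculus (star bilateralShift)

theorem laurentOp_circleCoord :
    laurentOp circleCoord = star (bilateralShift : L2 ℤ →L[ℂ] L2 ℤ) :=
  circleCalculus_circleCoord _

theorem laurentOp_star_circleCoord : laurentOp (star circleCoord) = bilateralShift := by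
  rw [map_star, laurentOp_circleCoord, star_star]

theorem norm_laurentOp (f : C(Circle, ℂ)) : ‖laurentOp f‖ = ‖f‖ :=
  norm_circleCalculus (u := star bilateralShift) circle_mem_spectrum_star_bilateralShift f

/-- The Toeplitz operator with symbol `f`, the compression of a Laurent operator to `ℓ²(ℕ)`. -/
def toeplitzOp : C(Circle, ℂ) →ₗ[ℂ] (L2 ℕ →L[ℂ] L2 ℕ) where
  toFun f := natEmbedding.adjoint ∘L laurentOp f ∘L natEmbedding
  map_add' f g := by rw [map_add, ContinuousLinearMap.add_comp, ContinuousLinearMap.comp_add]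
  map_smul' c f := by
    rw [map_smul, ContinuousLinearMap.smul_comp, ContinuousLinearMap.comp_smul, RingHom.id_apply]

theorem toeplitzOp_apply (f : C(Circle, ℂ)) :
    toeplitzOp f = natEmbedding.adjoint ∘L laurentOp f ∘L natEmbedding := rfl

theorem norm_toeplitzOp_le (f : C(Circle, ℂ)) : ‖toeplitzOp f‖ ≤ ‖f‖ := by
  calc ‖toeplitzOp f‖ ≤ ‖natEmbedding.adjoint‖ * (‖laurentOp f‖ * ‖natEmbedding‖) :=
        (ContinuousLinearMap.opNorm_comp_le _ _).trans
          (by gcongr; exact ContinuousLinearMap.opNorm_comp_le _ _)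
    _ ≤ 1 * (‖laurentOp f‖ * 1) := by
      gcongr
      exacts [norm_adjoint_natEmbedding_le, norm_natEmbedding_le]
    _ = ‖f‖ := by rw [one_mul, mul_one, norm_laurentOp]

theorem continuous_toeplitzOp : Continuous toeplitzOp :=
  AddMonoidHomClass.continuous_of_bound toeplitzOp 1 fun f => by
    rw [one_mul]; exact norm_toeplitzOp_le f

theorem toeplitzOp_one : toeplitzOp 1 = 1 := by
  rw [toeplitzOp_apply, map_one]
  exact adjoint_comp_natEmbedding

theorem toeplitzOp_star (f : C(Circle, ℂ)) : toeplitzOp (star f) = star (toeplitzOp f) := by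
  simp only [toeplitzOp_apply, map_star, ContinuousLinearMap.star_eq_adjoint,
    ContinuousLinearMap.adjoint_comp, ContinuousLinearMap.adjoint_adjoint,
    ContinuousLinearMap.comp_assoc]

theorem toeplitzOp_mul_star_circleCoord (f : C(Circle, ℂ)) :
    toeplitzOp (f * star circleCoord) = toeplitzOp f * shift := by
  rw [toeplitzOp_apply, map_mul, laurentOp_star_circleCoord, ContinuousLinearMap.mul_def,
    ContinuousLinearMap.comp_assoc, bilateralShift_comp_natEmbedding]
  rfl

theorem toeplitzOp_star_circleCoord : toeplitzOp (star circleCoord) = shift := by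
  rw [← one_mul (star circleCoord), toeplitzOp_mul_star_circleCoord, toeplitzOp_one, one_mul]

theorem toeplitzOp_circleCoord : toeplitzOp circleCoord = star shift := by
  rw [← star_star circleCoord, toeplitzOp_star, toeplitzOp_star_circleCoord]

theorem toeplitzOp_eq_window_comp (f : C(Circle, ℂ)) (k : ℕ) :
    toeplitzOp f = window k ∘L laurentOp f ∘L (window k).adjoint := by
  have hcomm : Commute (bilateralShift ^ k : L2 ℤ →L[ℂ] L2 ℤ) (laurentOp f) := by
    rw [← laurentOp_star_circleCoord]
    exact ((Commute.all _ _).map laurentOp).pow_left k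
  have hconj : (bilateralShift ^ k : L2 ℤ →L[ℂ] L2 ℤ) * laurentOp f * star (bilateralShift ^ k) =
      laurentOp f := by
    rw [hcomm.eq, mul_assoc, bilateralShift_pow_mul_star, mul_one]
  conv_lhs => rw [toeplitzOp_apply, ← hconj]
  rw [adjoint_window]
  rfl

end ToeplitzOperators

section Semicommutators

theorem isCompactOperator_toeplitzOp_mul_circleCoord_sub (f : C(Circle, ℂ)) :
    IsCompactOperator (toeplitzOp (f * circleCoord) - toeplitzOp f * toeplitzOp circleCoord) := by
  have hmul : toeplitzOp f = toeplitzOp (f * circleCoord) * shift := by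
    rw [← toeplitzOp_mul_star_circleCoord, mul_assoc, circleCoord_mul_star, mul_one]
  have hfactor : toeplitzOp (f * circleCoord) - toeplitzOp f * toeplitzOp circleCoord =
      toeplitzOp (f * circleCoord) * (1 - shift * star shift) := by
    rw [mul_sub, mul_one, ← mul_assoc, ← hmul, toeplitzOp_circleCoord]
  rw [hfactor, one_sub_shift_mul_star]
  exact (isCompactOperator_rankOne _ _).clm_comp (toeplitzOp (f * circleCoord))

/-- The symbols `f` for which all the semicommutators `T_{gf} - T_g T_f` are compact. -/
def semicommutingSymbols : Subalgebra ℂ C(Circle, ℂ) where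
  carrier := {f | ∀ g, IsCompactOperator (toeplitzOp (g * f) - toeplitzOp g * toeplitzOp f)}
  add_mem' {f₁ f₂} h₁ h₂ g := by
    rw [mul_add, map_add, map_add, mul_add, add_sub_add_comm]
    exact (h₁ g).add (h₂ g)
  mul_mem' {f₁ f₂} h₁ h₂ g := by
    have hsplit : toeplitzOp (g * (f₁ * f₂)) - toeplitzOp g * toeplitzOp (f₁ * f₂) =
        toeplitzOp (g * f₁ * f₂) - toeplitzOp (g * f₁) * toeplitzOp f₂ +
          (toeplitzOp (g * f₁) - toeplitzOp g * toeplitzOp f₁) * toeplitzOp f₂ -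
          toeplitzOp g * (toeplitzOp (f₁ * f₂) - toeplitzOp f₁ * toeplitzOp f₂) := by
      rw [mul_assoc g]
      noncomm_ring
    rw [hsplit]
    exact ((h₂ (g * f₁)).add ((h₁ g).comp_clm _)).sub ((h₂ f₁).clm_comp (toeplitzOp g))
  algebraMap_mem' c g := by
    rw [Algebra.algebraMap_eq_smul_one, mul_smul_comm, map_smul, map_smul, toeplitzOp_one,
      mul_smul_comm, mul_one, mul_one, sub_self]
    exact isCompactOperator_zero

theorem isClosed_semicommutingSymbols : IsClosed (semicommutingSymbols : Set C(Circle, ℂ)) := by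
  have hcont (g : C(Circle, ℂ)) :
      Continuous fun f => toeplitzOp (g * f) - toeplitzOp g * toeplitzOp f :=
    (continuous_toeplitzOp.comp (continuous_const.mul continuous_id)).sub
      (continuous_const.mul continuous_toeplitzOp)
  exact (congrArg IsClosed (Set.ofPred_forall _)).mpr
    (isClosed_iInter fun g => isClosed_setOfPred_isCompactOperator.preimage (hcont g))

theorem isCompactOperator_semicommutator (f g : C(Circle, ℂ)) :
    IsCompactOperator (toeplitzOp (f * g) - toeplitzOp f * toeplitzOp g) := by
  have htop : semicommutingSymbols = ⊤ :=
    subalgebra_eq_top_of_injective _ isClosed_semicommutingSymbols circleCoord_injective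
      isCompactOperator_toeplitzOp_mul_circleCoord_sub fun g => by
        rw [toeplitzOp_mul_star_circleCoord, toeplitzOp_star_circleCoord, sub_self]
        exact isCompactOperator_zero
  exact (htop.symm ▸ Algebra.mem_top : g ∈ semicommutingSymbols) f

theorem toeplitzOp_mem_toeplitz (f : C(Circle, ℂ)) : toeplitzOp f ∈ Toeplitz := by
  let N : Subalgebra ℂ C(Circle, ℂ) :=
    { carrier := {f | toeplitzOp f ∈ Toeplitz}
      add_mem' := fun h₁ h₂ => by
        rw [Set.mem_ofPred_eq, map_add]
        exact add_mem h₁ h₂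
      mul_mem' := fun {f₁ f₂} h₁ h₂ => by
        have h := mem_toeplitz_of_isCompactOperator (isCompactOperator_semicommutator f₁ f₂)
        simpa using add_mem h (mul_mem h₁ h₂)
      algebraMap_mem' := fun c => by
        rw [Set.mem_ofPred_eq, Algebra.algebraMap_eq_smul_one, map_smul, toeplitzOp_one]
        exact Toeplitz.toSubalgebra.smul_mem (one_mem _) c }
  have htop : N = ⊤ :=
    subalgebra_eq_top_of_injective _ (isClosed_toeplitz.preimage continuous_toeplitzOp)
      circleCoord_injective
      (toeplitzOp_circleCoord ▸ (star genT).2 : toeplitzOp circleCoord ∈ Toeplitz)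
      (toeplitzOp_star_circleCoord ▸ genT.2 : toeplitzOp (star circleCoord) ∈ Toeplitz)
  exact (htop.symm ▸ Algebra.mem_top : f ∈ N)

theorem tendsto_inner_window {f : C(Circle, ℂ)} {A : L2 ℕ →L[ℂ] L2 ℕ}
    (h : IsCompactOperator (A - toeplitzOp f)) (x y : L2 ℤ) :
    Tendsto (fun k => ⟪A (window k x), window k y⟫_ℂ) atTop (𝓝 ⟪laurentOp f x, y⟫_ℂ) := by
  have hcompact : Tendsto (fun k => ⟪(A - toeplitzOp f) (window k x), window k y⟫_ℂ)
      atTop (𝓝 0) := by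
    have hzero := tendsto_apply_zero_of_isCompactOperator (stdBasis ℕ)
      (fun k => norm_window_apply_le k x) (tendsto_inner_stdBasis_window · x) h
    refine squeeze_zero_norm (fun k => ?_) (by simpa using hzero.norm.mul_const ‖y‖)
    exact (norm_inner_le_norm _ _).trans 
      (mul_le_mul_of_nonneg_left (norm_window_apply_le k y) (norm_nonneg _))
  have htoeplitz : Tendsto (fun k => ⟪toeplitzOp f (window k x), window k y⟫_ℂ) atTop
      (𝓝 ⟪laurentOp f x, y⟫_ℂ) := by
    refine ((((laurentOp f).continuous.tendsto x).comp (tendsto_adjoint_window_window x)).inner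
      (tendsto_adjoint_window_window y)).congr fun k => ?_
    rw [toeplitzOp_eq_window_comp f k, ContinuousLinearMap.adjoint_inner_right]
    rfl
  simpa only [_root_.sub_apply, inner_sub_left, sub_add_cancel, zero_add] using
    hcompact.add htoeplitz

theorem norm_le_of_isCompactOperator_sub {f : C(Circle, ℂ)} {A : L2 ℕ →L[ℂ] L2 ℕ}
    (h : IsCompactOperator (A - toeplitzOp f)) : ‖f‖ ≤ ‖A‖ := by
  rw [← norm_laurentOp]
  refine ContinuousLinearMap.opNorm_le_of_re_inner_le (norm_nonneg A) fun x y hx hy => ?_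
  refine (Complex.re_le_norm _).trans
    (le_of_tendsto (tendsto_inner_window h x y).norm (Eventually.of_forall fun k => ?_))
  calc ‖⟪A (window k x), window k y⟫_ℂ‖ ≤ ‖A (window k x)‖ * ‖window k y‖ := norm_inner_le_norm _ _
    _ ≤ ‖A‖ * ‖window k x‖ * ‖window k y‖ := by gcongr; exact A.le_opNorm _
    _ ≤ ‖A‖ * ‖x‖ * ‖y‖ := by gcongr <;> exact norm_window_apply_le k _
    _ = ‖A‖ := by rw [hx, hy, mul_one, mul_one]

end Semicommutators

section Symbol

theorem toeplitzOp_star_circleCoord_pow (n : ℕ) :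
    toeplitzOp (star circleCoord ^ n) = shift ^ n := by
  induction n with
  | zero => exact toeplitzOp_one
  | succ n ih => rw [pow_succ, toeplitzOp_mul_star_circleCoord, ih, pow_succ]

theorem toeplitzOp_circleCoord_pow (m : ℕ) : toeplitzOp (circleCoord ^ m) = star shift ^ m := by
  rw [← star_star (circleCoord ^ m), toeplitzOp_star, star_pow, toeplitzOp_star_circleCoord_pow,
    star_pow]

theorem isCompactOperator_opT_sub_toeplitzOp (n m : ℕ) :
    IsCompactOperator
      (opT n m - toeplitzOp (star circleCoord ^ n * circleCoord ^ m) : L2 ℕ →L[ℂ] L2 ℕ) := by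
  rw [coe_opT, ← toeplitzOp_star_circleCoord_pow, ← toeplitzOp_circleCoord_pow, ← neg_sub]
  exact (isCompactOperator_semicommutator _ _).neg

/-- The isometry `f ↦ [T_f]` of `C(S¹)` into `𝒯/𝒦`, which is the inverse of the symbol map. -/
def toeplitzClass : C(Circle, ℂ) →ₗᵢ[ℂ] Toeplitz ⧸ compactIdeal where
  toLinearMap := compactIdeal.mkQ ∘ₗ
    toeplitzOp.codRestrict Toeplitz.toSubalgebra.toSubmodule toeplitzOp_mem_toeplitz
  norm_map' f := by
    refine le_antisymm ((Submodule.Quotient.norm_mk_le _ _).trans (norm_toeplitzOp_le f))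
      (le_of_forall_pos_lt_add fun δ hδ => ?_)
    obtain ⟨A, hA, hlt⟩ := Submodule.Quotient.norm_mk_lt
      (Submodule.Quotient.mk ⟨toeplitzOp f, toeplitzOp_mem_toeplitz f⟩ : Toeplitz ⧸ compactIdeal) hδ
    exact (norm_le_of_isCompactOperator_sub ((Submodule.Quotient.eq _).1 hA)).trans_lt hlt

theorem mk_eq_toeplitzClass_iff {A : Toeplitz} {f : C(Circle, ℂ)} :
    Submodule.Quotient.mk A = toeplitzClass f ↔
      IsCompactOperator (A - toeplitzOp f : L2 ℕ →L[ℂ] L2 ℕ) :=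
  Submodule.Quotient.eq _

instance isClosed_compactIdeal : IsClosed (compactIdeal : Set Toeplitz) :=
  isClosed_setOfPred_isCompactOperator.preimage continuous_subtype_val

theorem toeplitzClass_surjective : Function.Surjective toeplitzClass := by
  let V : Submodule ℂ Toeplitz := (LinearMap.range toeplitzClass.toLinearMap).comap compactIdeal.mkQ
  have hclosed : IsClosed (V : Set Toeplitz) :=
    toeplitzClass.isometry.isClosedEmbedding.isClosed_range.preimage continuous_quot_mk
  have hspan : Submodule.span ℂ (Set.range fun p : ℕ × ℕ => opT p.1 p.2) ≤ V := by
    rw [Submodule.span_le]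
    rintro _ ⟨⟨n, m⟩, rfl⟩
    exact ⟨_, (mk_eq_toeplitzClass_iff.2 (isCompactOperator_opT_sub_toeplitzOp n m)).symm⟩
  intro x
  obtain ⟨A, rfl⟩ := Submodule.Quotient.mk_surjective _ x
  exact hclosed.closure_subset_iff.2 hspan (dense_span_opT A)

/-- The isometric isomorphism of the quotient of `𝒯` by the compact operators with `C(S¹)`. -/
def symbolEquiv : (Toeplitz ⧸ compactIdeal) ≃ₗᵢ[ℂ] C(Circle, ℂ) :=
  (LinearIsometryEquiv.ofSurjective toeplitzClass toeplitzClass_surjective).symm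

theorem symbolEquiv_mk_eq_iff {A : Toeplitz} {f : C(Circle, ℂ)} :
    symbolEquiv (Submodule.Quotient.mk A) = f ↔
      IsCompactOperator (A - toeplitzOp f : L2 ℕ →L[ℂ] L2 ℕ) :=
  (LinearIsometryEquiv.symm_apply_eq _).trans mk_eq_toeplitzClass_iff

theorem isCompactOperator_mul_sub_toeplitzOp_mul {A B : L2 ℕ →L[ℂ] L2 ℕ} {f g : C(Circle, ℂ)}
    (hA : IsCompactOperator (A - toeplitzOp f)) (hB : IsCompactOperator (B - toeplitzOp g)) :
    IsCompactOperator (A * B - toeplitzOp (f * g)) := by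
  have hsplit : A * B - toeplitzOp (f * g) = (A - toeplitzOp f) * B +
      toeplitzOp f * (B - toeplitzOp g) - (toeplitzOp (f * g) - toeplitzOp f * toeplitzOp g) := by
    noncomm_ring
  rw [hsplit]
  exact ((hA.comp_clm B).add (hB.clm_comp (toeplitzOp f))).sub
    (isCompactOperator_semicommutator f g)

/-- The symbol map as a homomorphism of algebras; it preserves the involution automatically. -/
def symbolAlgHom : Toeplitz →ₐ[ℂ] C(Circle, ℂ) :=
  AlgHom.ofLinearMap (symbolEquiv.toLinearIsometry.toLinearMap ∘ₗ compactIdeal.mkQ)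
    (symbolEquiv_mk_eq_iff.2 (by
      rw [toeplitzOp_one, OneMemClass.coe_one, sub_self]; exact isCompactOperator_zero))
    fun A B => symbolEquiv_mk_eq_iff.2 (isCompactOperator_mul_sub_toeplitzOp_mul
      (symbolEquiv_mk_eq_iff.1 rfl) (symbolEquiv_mk_eq_iff.1 rfl))

/-- The symbol map `γ : 𝒯 → C(S¹)`. -/
def symbol : Toeplitz →⋆ₐ[ℂ] C(Circle, ℂ) where
  __ := symbolAlgHom
  map_star' A := by
    ext z
    exact map_star ((ContinuousMap.evalAlgHom ℂ ℂ z).comp symbolAlgHom) A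

theorem symbol_apply (A : Toeplitz) : symbol A = symbolEquiv (Submodule.Quotient.mk A) := rfl

theorem symbol_opT (n m : ℕ) (z : Circle) :
    symbol (opT n m) z = (z : ℂ) ^ ((m : ℤ) - (n : ℤ)) := by
  rw [symbol_apply, symbolEquiv_mk_eq_iff.2 (isCompactOperator_opT_sub_toeplitzOp n m)]
  change conj (z : ℂ) ^ n * (z : ℂ) ^ m = _
  rw [← Circle.coe_inv_eq_conj, Circle.coe_inv, zpow_sub₀ z.coe_ne_zero, zpow_natCast, zpow_natCast,
    inv_pow, div_eq_inv_mul]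

end Symbol

section Counit

/-- The counit of `𝒯`: the evaluation of the symbol at `1`. -/
def counit : StrongDual ℂ Toeplitz :=
  ((ContinuousMap.evalAlgHom ℂ ℂ 1).comp symbolAlgHom).toContinuousLinearMap

theorem counit_apply (A : Toeplitz) : counit A = symbol A 1 := rfl

theorem counit_opT (n m : ℕ) : counit (opT n m) = 1 := by
  rw [counit_apply, symbol_opT, Circle.coe_one, one_zpow]

theorem norm_counit : ‖counit‖ = 1 :=
  have : Nontrivial Toeplitz := symbolAlgHom.toRingHom.domain_nontrivial
  AlgHom.toContinuousLinearMap_norm _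

theorem mul_eq_right_of_forall_opT {ε : StrongDual ℂ Toeplitz} (hε : ∀ n m, ε (opT n m) = 1)
    (ρ : StrongDual ℂ Toeplitz) : ε * ρ = ρ :=
  dual_ext fun n m => (conv_opT _ _ n m).trans (by rw [hε, one_mul])

theorem sliceLeft_comul_of_forall_opT {ε : StrongDual ℂ Toeplitz} (hε : ∀ n m, ε (opT n m) = 1)
    (A : Toeplitz) : sliceLeft Toeplitz Toeplitz ε (comul A) = A := by
  have h : sliceLeft Toeplitz Toeplitz ε ∘L comulL = .id ℂ Toeplitz := by
    refine ContinuousLinearMap.ext_on dense_span_opT ?_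
    rintro _ ⟨⟨n, m⟩, rfl⟩
    rw [ContinuousLinearMap.comp_apply, comulL_apply, comul_opT, sliceLeft_elemTensor, hε,
      one_smul, ContinuousLinearMap.id_apply]
  exact DFunLike.congr_fun h A

theorem sliceRight_comul_of_forall_opT {ε : StrongDual ℂ Toeplitz} (hε : ∀ n m, ε (opT n m) = 1)
    (A : Toeplitz) : sliceRight Toeplitz Toeplitz ε (comul A) = A := by
  have h : sliceRight Toeplitz Toeplitz ε ∘L comulL = .id ℂ Toeplitz := by
    refine ContinuousLinearMap.ext_on dense_span_opT ?_
    rintro _ ⟨⟨n, m⟩, rfl⟩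
    rw [ContinuousLinearMap.comp_apply, comulL_apply, comul_opT, sliceRight_elemTensor, hε,
      one_smul, ContinuousLinearMap.id_apply]
  exact DFunLike.congr_fun h A

end Counit

end ToeplitzQSG

end

theorem lemma6 :
    -- the compact operators lie in the Toeplitz algebra
    (∀ K : L2 ℕ →L[ℂ] L2 ℕ, IsCompactOperator K → K ∈ Toeplitz) ∧
    ∃ ε : StrongDual ℂ Toeplitz,
      -- the functional with value 1 at all T_{n,m} extends, uniquely, to a continuous functional
      (∀ n m : ℕ, ε (opT n m) = 1) ∧
      (∀ ε' : StrongDual ℂ Toeplitz, (∀ n m : ℕ, ε' (opT n m) = 1) → ε' = ε) ∧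
      -- it is the evaluation at 1 of the symbol map
      (∃ (Φ : (Toeplitz ⧸ compactIdeal) ≃ₗᵢ[ℂ] C(Circle, ℂ)) (γ : Toeplitz →⋆ₐ[ℂ] C(Circle, ℂ)),
        (∀ A : Toeplitz, γ A = Φ (Submodule.Quotient.mk A)) ∧
        (∀ (n m : ℕ) (z : Circle), γ (opT n m) z = (z : ℂ) ^ ((m : ℤ) - (n : ℤ))) ∧
        (∀ A : Toeplitz, ε A = γ A 1)) ∧
      -- it is the unit of the Banach algebra of continuous functionals
      ‖ε‖ = 1 ∧
      (∀ ρ : StrongDual ℂ Toeplitz, ε * ρ = ρ ∧ ρ * ε = ρ) ∧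
      -- it is a counit
      (∀ A : Toeplitz, sliceLeft Toeplitz Toeplitz ε (comul A) = A ∧
        sliceRight Toeplitz Toeplitz ε (comul A) = A) := by
  refine ⟨fun K hK => mem_toeplitz_of_isCompactOperator hK, counit, counit_opT,
    fun ε' hε' => dual_ext fun n m => (hε' n m).trans (counit_opT n m).symm,
    ⟨symbolEquiv, symbol, symbol_apply, symbol_opT, counit_apply⟩, norm_counit, fun ρ => ?_,
    fun A => ?_⟩
  · have hleft : counit * ρ = ρ := mul_eq_right_of_forall_opT counit_opT ρ
    exact ⟨hleft, (mul_comm ρ counit).trans hleft⟩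
  · exact ⟨sliceLeft_comul_of_forall_opT counit_opT A,
      sliceRight_comul_of_forall_opT counit_opT A⟩
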